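/- Let $G$ be a Lie group, $M$ a connected smooth manifold with a smooth left action of $G$, and $p\colon P\to M$ a $G$-equivariant principal $U(1)$-bundle, i.e. a smooth principal $U(1)$-bundle with a smooth left action of $G$ on $P$ by principal bundle automorphisms covering the action on $M$. Let $\Xi\in\Omega^1(P,i\mathbb{R})$ be a $G$-invariant connection. Its curvature $\mathrm{curv}(\Xi)\in\Omega^2(M)$ is defined by $p^*\mathrm{curv}(\Xi)=\frac{i}{2\pi}d\Xi$, and its momentum by $p^*\mu^\Xi_X=-\frac{i}{2\pi}\Xi(X_P)$ for $X\in\mathfrak g$, where $X_P(y)=\frac{d}{dt}\big|_{t=0}\exp(-tX)\cdot y$. Suppose that $\Xi$ is $G$-flat: $\mathrm{curv}(\Xi)=0$ and $\mu^\Xi=0$. Fix $x\in M$. Let $\mathcal{C}^G_x(M)$ be the set of pairs $(\phi,\gamma)$ with $\phi\in G$ and $\gamma\colon[0,1]\to M$ a piecewise $C^1$ curve with $\gamma(0)=x$, $\gamma(1)=\phi\cdot x$. The equivariant holonomy $\mathrm{Hol}^\Xi_\phi(\gamma)\in U(1)$ is characterized by $\overline{\gamma}^{y}(1)=(\phi\cdot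 y)\cdot\mathrm{Hol}^\Xi_\phi(\gamma)$ for every $y\in p^{-1}(x)$, where $\overline{\gamma}^{y}$ is the $\Xi$-horizontal lift of $\gamma$ starting at $y$. Write $(\phi,\gamma)\sim_G(\phi',\gamma')$ if there are a piecewise $C^1$ curve $t\mapsto\varphi_t$, $t\in[0,1]$, in $G$ and a continuous map $[0,1]\times[0,1]\to M$, $(t,s)\mapsto h_t(s)$, such that $(\varphi_t,h_t)\in\mathcal{C}^G_x(M)$ for all $t$, $(\varphi_0,h_0)=(\phi,\gamma)$ and $(\varphi_1,h_1)=(\phi',\gamma')$. The equivariant fundamental group is $\pi_{1,G}(M)_x=\mathcal{C}^G_x(M)/\!\sim_G$ with the product $[(\phi,\gamma)]*[(\phi',\gamma')]=[(\phi\phi',\gamma*(\phi\cdot\gamma'))]$, where $*$ on curves is concatenation and $(\phi\cdot\gamma')(s)=\phi\cdot\gamma'(s)$. Then the equivariant holonomy is well defined, and if $(\phi,\gamma)\sim_G(\phi',\gamma')$ then $\mathrm{Hol}^\Xi_\phi(\gamma)=\mathrm{Hol}^\Xi_{\phi'}(\gamma')$. Hence the equivariant holonomy induces a group homomorphism $\mathrm{Hol}^\Xi_G\colon\pi_{1,G}(M)_x\to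 U(1)$, $[(\phi,\gamma)]\mapsto\mathrm{Hol}^\Xi_\phi(\gamma)$. -/

import Mathlib

open Set
open scoped Manifold ContDiff Topology RightActions

set_option linter.unusedSectionVars false

noncomputable section

/-! ### Piecewise `C¹` curves -/

section Piecewise

variable {E : Type*} [NormedAddCommGroup E] [NormedSpace ℝ E] {H : Type*} [TopologicalSpace H]
  {X : Type*} [TopologicalSpace X] [ChartedSpace H X]

/-- `γ` is piecewise `C¹` on `[a, b]`: it is continuous there, and there is a finite set `F` of
break points such that `γ` is `C¹` (up to the end points) on every subinterval `[c, d]` of `[a, b]`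
whose interior contains no break point. -/
def PiecewiseC1On (J : ModelWithCorners ℝ E H) (γ : ℝ → X) (a b : ℝ) : Prop :=
  ContinuousOn γ (Icc a b) ∧ ∃ F : Finset ℝ, ∀ c d : ℝ, a ≤ c → c < d → d ≤ b →
    (∀ r ∈ F, r ∉ Ioo c d) → ContMDiffOn 𝓘(ℝ, ℝ) J 1 γ (Icc c d)

/-- A curve `γ : [0,1] → X` is piecewise `C¹`. -/
def PiecewiseC1 (J : ModelWithCorners ℝ E H) (γ : unitInterval → X) : Prop :=
  PiecewiseC1On J (IccExtend zero_le_one γ) 0 1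

variable {J : ModelWithCorners ℝ E H} {γ δ : ℝ → X} {a b c : ℝ}

theorem PiecewiseC1On.glue (h₁ : PiecewiseC1On J γ a b) (h₂ : PiecewiseC1On J γ b c)
    (hab : a ≤ b) (hbc : b ≤ c) : PiecewiseC1On J γ a c := by
  obtain ⟨k₁, F₁, h₁⟩ := h₁
  obtain ⟨k₂, F₂, h₂⟩ := h₂
  refine ⟨?_, insert b (F₁ ∪ F₂), fun u v hu huv hv hF => ?_⟩
  · rw [← Icc_union_Icc_eq_Icc hab hbc]
    exact k₁.union_of_isClosed k₂ isClosed_Icc isClosed_Icc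
  · have hb : b ∉ Ioo u v := hF b (by simp)
    by_cases hvb : v ≤ b
    · exact h₁ u v hu huv hvb fun r hr => hF r (by simp [hr])
    · have hbu : b ≤ u := by
        by_contra hlt
        exact hb ⟨not_le.1 hlt, not_le.1 hvb⟩
      exact h₂ u v hbu huv hv fun r hr => hF r (by simp [hr])

theorem PiecewiseC1On.of_affine (h : PiecewiseC1On J γ 0 1) (m k : ℝ)
    (hm : ∀ s ∈ Icc a b, m * s + k ∈ Icc (0 : ℝ) 1) (he : ∀ s ∈ Icc a b, δ s = γ (m * s + k)) :
    PiecewiseC1On J δ a b := by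
  obtain ⟨k₁, F, h⟩ := h
  refine ⟨?_, F.image (fun r => (r - k) / m), fun u v hu huv hv hF => ?_⟩
  · exact (k₁.comp (by fun_prop : ContinuousOn (fun s : ℝ => m * s + k) (Icc a b)) hm).congr he
  have hsub : Icc u v ⊆ Icc a b := Icc_subset_Icc hu hv
  have hsm : ∀ S : Set ℝ, ContMDiffOn 𝓘(ℝ, ℝ) 𝓘(ℝ, ℝ) 1 (fun s : ℝ => m * s + k) S := fun S =>
    (by fun_prop : ContDiff ℝ 1 (fun s : ℝ => m * s + k)).contMDiff.contMDiffOn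
  have hum := hm u (hsub (left_mem_Icc.2 huv.le))
  have hvm := hm v (hsub (right_mem_Icc.2 huv.le))
  rcases lt_trichotomy m 0 with hm0 | hm0 | hm0
  · have := h (m * v + k) (m * u + k) hvm.1 (by nlinarith) hum.2 (fun r hr hr' => by
      refine hF ((r - k) / m) (Finset.mem_image_of_mem _ hr) ⟨?_, ?_⟩
      · rw [lt_div_iff_of_neg hm0]; linarith [hr'.2]
      · rw [div_lt_iff_of_neg hm0]; linarith [hr'.1])
    refine (this.comp (hsm (Icc u v)) (fun s hs => ⟨?_, ?_⟩)).congr fun s hs => he s (hsub hs)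
    · nlinarith [hs.2]
    · nlinarith [hs.1]
  · refine (contMDiffOn_const (c := γ k)).congr fun s hs => ?_
    rw [he s (hsub hs), hm0, zero_mul, zero_add]
  · have := h (m * u + k) (m * v + k) hum.1 (by nlinarith) hvm.2 (fun r hr hr' => by
      refine hF ((r - k) / m) (Finset.mem_image_of_mem _ hr) ⟨?_, ?_⟩
      · rw [lt_div_iff₀ hm0]; linarith [hr'.1]
      · rw [div_lt_iff₀ hm0]; linarith [hr'.2])
    refine (this.comp (hsm (Icc u v)) (fun s hs => ⟨?_, ?_⟩)).congr fun s hs => he s (hsub hs)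
    · nlinarith [hs.1]
    · nlinarith [hs.2]

theorem PiecewiseC1On.map {E' : Type*} [NormedAddCommGroup E'] [NormedSpace ℝ E'] {H' : Type*}
    [TopologicalSpace H'] {Y : Type*} [TopologicalSpace Y] [ChartedSpace H' Y]
    {J' : ModelWithCorners ℝ E' H'} {f : X → Y} (hf : ContMDiff J J' 1 f)
    (h : PiecewiseC1On J γ a b) : PiecewiseC1On J' (fun t => f (γ t)) a b := by
  obtain ⟨k, F, h⟩ := h
  exact ⟨hf.continuous.comp_continuousOn k, F,
    fun u v hu huv hv hF => hf.comp_contMDiffOn (h u v hu huv hv hF)⟩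

theorem PiecewiseC1On.mul [Group X] [LieGroup J ∞ X]
    (h : PiecewiseC1On J γ a b) (h' : PiecewiseC1On J δ a b) :
    PiecewiseC1On J (fun t => γ t * δ t) a b := by
  have : IsTopologicalGroup X := topologicalGroup_of_lieGroup J ∞
  obtain ⟨k, F, h⟩ := h
  obtain ⟨k', F', h'⟩ := h'
  refine ⟨k.mul k', F ∪ F', fun u v hu huv hv hF => ?_⟩
  exact (h u v hu huv hv fun r hr => hF r (by simp [hr])).mul
    (h' u v hu huv hv fun r hr => hF r (by simp [hr]))

theorem piecewiseC1On_const (x : X) : PiecewiseC1On J (fun _ => x) a b :=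
  ⟨continuousOn_const, ∅, fun _ _ _ _ _ _ => contMDiffOn_const⟩

end Piecewise

/-! ### Equivariant loops and the equivariant fundamental group -/

section FundamentalGroup

variable {EG : Type*} [NormedAddCommGroup EG] [NormedSpace ℝ EG] {HG : Type*} [TopologicalSpace HG]
  {EM : Type*} [NormedAddCommGroup EM] [NormedSpace ℝ EM] {HM : Type*} [TopologicalSpace HM]

/-- A pair `(φ, γ)` with `φ ∈ G` and `γ : [0,1] → M` a piecewise `C¹` curve such that `γ 0 = x` and
`γ 1 = φ • x`. The curves with a given first component `φ` form `C_x^φ(M)`, the whole type is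
`C_x^G(M)`. -/
@[ext]
structure EquivLoop (IM : ModelWithCorners ℝ EM HM) (G : Type*) [Group G] {M : Type*}
    [TopologicalSpace M] [ChartedSpace HM M] [MulAction G M] (x : M) where
  g : G
  curve : C(unitInterval, M)
  source : curve 0 = x
  target : curve 1 = g • x
  piecewiseC1 : PiecewiseC1 IM curve

variable (IG : ModelWithCorners ℝ EG HG) (IM : ModelWithCorners ℝ EM HM)
  (G : Type*) [TopologicalSpace G] [ChartedSpace HG G] [Group G]
  {M : Type*} [TopologicalSpace M] [ChartedSpace HM M] [MulAction G M] (x : M)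

namespace EquivLoop

variable {IM G x}

/-- The relation `∼_G`: there is a (piecewise `C¹`) curve `t ↦ φ_t` in `G` and a continuous map
`(t, s) ↦ h_t(s)` such that each `h_t` is a piecewise `C¹` curve from `x` to `φ_t • x`, joining the
two given pairs. -/
def Homotopic (a b : EquivLoop IM G x) : Prop :=
  ∃ h : unitInterval → EquivLoop IM G x, PiecewiseC1 IG (fun t => (h t).g) ∧
    Continuous (fun p : unitInterval × unitInterval => (h p.1).curve p.2) ∧ h 0 = a ∧ h 1 = b

variable {IG}

/-- The curve of an equivariant loop as a path. -/
def path (a : EquivLoop IM G x) : Path x (a.g • x) := ⟨a.curve, a.source, a.target⟩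

theorem path_apply (a : EquivLoop IM G x) (s : unitInterval) : a.path s = a.curve s := rfl

theorem extend_eq (a : EquivLoop IM G x) : ⇑a.path.extend = IccExtend zero_le_one a.curve := rfl

theorem pw (a : EquivLoop IM G x) : PiecewiseC1On IM a.path.extend 0 1 := a.piecewiseC1

theorem Homotopic.refl (a : EquivLoop IM G x) : Homotopic IG a a :=
  ⟨fun _ => a, piecewiseC1On_const _, by fun_prop, rfl, rfl⟩

theorem Homotopic.symm {a b : EquivLoop IM G x} (h : Homotopic IG a b) : Homotopic IG b a := by
  obtain ⟨h, hg, hc, h0, h1⟩ := h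
  refine ⟨fun t => h (unitInterval.symm t), ?_, ?_, by simp [h1], by simp [h0]⟩
  · refine PiecewiseC1On.of_affine hg (-1) 1 (fun s hs => ⟨by linarith [hs.2], by linarith [hs.1]⟩)
      fun s hs => ?_
    have hs' : -1 * s + 1 ∈ Icc (0 : ℝ) 1 := ⟨by linarith [hs.2], by linarith [hs.1]⟩
    rw [IccExtend_of_mem _ _ hs, IccExtend_of_mem _ _ hs']
    have he : unitInterval.symm ⟨s, hs⟩ = ⟨-1 * s + 1, hs'⟩ := by
      apply Subtype.ext
      simp [unitInterval.symm]
      ring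
    rw [← he]
  · exact hc.comp (by fun_prop : Continuous fun p : unitInterval × unitInterval => (unitInterval.symm p.1, p.2))

theorem Homotopic.trans {a b c : EquivLoop IM G x} (h : Homotopic IG a b)
    (h' : Homotopic IG b c) : Homotopic IG a c := by
  obtain ⟨h, hg, hc, h0, h1⟩ := h
  obtain ⟨k, kg, kc, k0, k1⟩ := h'
  let P : ℝ → unitInterval := projIcc (0 : ℝ) 1 zero_le_one
  have hP : Continuous P := continuous_projIcc
  refine ⟨fun t => if (t : ℝ) ≤ 1 / 2 then h (P (2 * t)) else k (P (2 * t - 1)), ?_, ?_, ?_, ?_⟩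
  · refine PiecewiseC1On.glue (b := 1 / 2) ?_ ?_ (by norm_num) (by norm_num)
    · refine PiecewiseC1On.of_affine hg 2 0
        (fun s hs => ⟨by linarith [hs.1], by linarith [hs.2]⟩) fun s hs => ?_
      have hs' : s ∈ Icc (0 : ℝ) 1 := ⟨hs.1, by linarith [hs.2]⟩
      rw [IccExtend_of_mem _ _ hs']
      simp only [IccExtend, Function.comp, add_zero]
      rw [if_pos hs.2]
    · refine PiecewiseC1On.of_affine kg 2 (-1)
        (fun s hs => ⟨by linarith [hs.1], by linarith [hs.2]⟩) fun s hs => ?_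
      have hs' : s ∈ Icc (0 : ℝ) 1 := ⟨by linarith [hs.1], hs.2⟩
      rw [IccExtend_of_mem _ _ hs']
      simp only [IccExtend, Function.comp, ← sub_eq_add_neg]
      split_ifs with hle
      · have : s = 1 / 2 := le_antisymm hle hs.1
        subst this
        norm_num [P, h1, k0]
      · rfl
  · have : (fun p : unitInterval × unitInterval => ((if (p.1 : ℝ) ≤ 1 / 2 then h (P (2 * p.1)) else
        k (P (2 * p.1 - 1))) : EquivLoop IM G x).curve p.2) = fun p : unitInterval × unitInterval =>
        if (p.1 : ℝ) ≤ 1 / 2 then (h (P (2 * p.1))).curve p.2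
        else (k (P (2 * p.1 - 1))).curve p.2 := by
      funext p
      split_ifs <;> rfl
    rw [this]
    refine Continuous.if_le ?_ ?_ (by fun_prop) continuous_const ?_
    · exact hc.comp (by fun_prop : Continuous fun p : unitInterval × unitInterval => (P (2 * p.1), p.2))
    · exact kc.comp (by fun_prop : Continuous fun p : unitInterval × unitInterval => (P (2 * p.1 - 1), p.2))
    · intro p hp
      rw [hp]
      norm_num [P, h1, k0]
  · simp [P, h0]
  · norm_num [P, k1]

variable (IG IM G x) in
/-- The relation `∼_G` on `C_x^G(M)` as a setoid. -/
def setoid : Setoid (EquivLoop IM G x) :=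
  ⟨Homotopic IG, Homotopic.refl, Homotopic.symm, Homotopic.trans⟩

/-- The unit `(e, constant curve)`. -/
protected def one : EquivLoop IM G x where
  g := 1
  curve := ContinuousMap.const unitInterval x
  source := rfl
  target := (one_smul G x).symm
  piecewiseC1 := piecewiseC1On_const x

variable (IG) in
theorem contMDiff_smul_left [ContMDiffSMul IG IM ∞ G M] (g : G) :
    ContMDiff IM IM 1 (fun y : M => g • y) := by
  have h : ContMDiff (IG.prod IM) IM ∞ (fun p : G × M => p.1 • p.2) := contMDiff_smul
  exact (h.comp (contMDiff_const.prodMk contMDiff_id)).of_le (by simp)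

variable (IG) in
/-- The product `(φ, γ) * (φ', γ') = (φ φ', γ * (φ · γ'))`, where the second `*` is the
concatenation of curves. -/
protected def mul [ContMDiffSMul IG IM ∞ G M] (a b : EquivLoop IM G x) : EquivLoop IM G x where
  g := a.g * b.g
  curve := (a.path.trans
    (b.path.map (contMDiff_smul_left IG (IM := IM) a.g).continuous)).toContinuousMap
  source := by simp
  target := by simp [mul_smul]
  piecewiseC1 := by
    refine PiecewiseC1On.glue (b := 1 / 2) ?_ ?_ (by norm_num) (by norm_num)
    · refine PiecewiseC1On.of_affine a.pw 2 0
        (fun s hs => ⟨by linarith [hs.1], by linarith [hs.2]⟩) fun s hs => ?_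
      have hs' : s ∈ Icc (0 : ℝ) 1 := ⟨hs.1, by linarith [hs.2]⟩
      rw [IccExtend_of_mem _ _ hs']
      change (if s ≤ 1 / 2 then _ else _) = _
      rw [if_pos hs.2, add_zero]
    · refine PiecewiseC1On.of_affine (b.pw.map (contMDiff_smul_left IG (IM := IM) a.g))
        2 (-1) (fun s hs => ⟨by linarith [hs.1], by linarith [hs.2]⟩) fun s hs => ?_
      have hs' : s ∈ Icc (0 : ℝ) 1 := ⟨by linarith [hs.1], hs.2⟩
      rw [IccExtend_of_mem _ _ hs']
      change (if s ≤ 1 / 2 then _ else _) = _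
      split_ifs with hle
      · have : s = 1 / 2 := le_antisymm hle hs.1
        subst this
        norm_num
      · rw [← sub_eq_add_neg]
        rfl

variable (IG) in
/-- The inverse `(φ⁻¹, φ⁻¹ · γ⁻)`, where `γ⁻` is the reversed curve. -/
protected def inv [ContMDiffSMul IG IM ∞ G M] (a : EquivLoop IM G x) : EquivLoop IM G x where
  g := a.g⁻¹
  curve := (a.path.symm.map
    (contMDiff_smul_left IG (IM := IM) a.g⁻¹).continuous).toContinuousMap
  source := by simp
  target := by simp
  piecewiseC1 := by
    refine PiecewiseC1On.of_affine (a.pw.map (contMDiff_smul_left IG (IM := IM) a.g⁻¹))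
      (-1) 1 (fun s hs => ⟨by linarith [hs.2], by linarith [hs.1]⟩) fun s hs => ?_
    have hs' : -1 * s + 1 ∈ Icc (0 : ℝ) 1 := ⟨by linarith [hs.2], by linarith [hs.1]⟩
    rw [IccExtend_of_mem _ _ hs, Path.extend_apply _ hs']
    change a.g⁻¹ • a.curve _ = a.g⁻¹ • a.curve _
    congr 2
    ext
    simp; ring

section Group

variable [LieGroup IG ∞ G] [ContMDiffSMul IG IM ∞ G M]

theorem one_curve (s : unitInterval) : (EquivLoop.one : EquivLoop IM G x).curve s = x := rfl

theorem mul_curve (a b : EquivLoop IM G x) (s : unitInterval) : (EquivLoop.mul IG a b).curve s =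
    if (s : ℝ) ≤ 1 / 2 then a.path.extend (2 * s) else a.g • b.path.extend (2 * s - 1) := rfl

theorem inv_curve (a : EquivLoop IM G x) (s : unitInterval) :
    (EquivLoop.inv IG a).curve s = a.g⁻¹ • a.curve (unitInterval.symm s) := rfl

theorem continuous_g {h : unitInterval → EquivLoop IM G x} (hg : PiecewiseC1 IG (fun t => (h t).g)) :
    Continuous fun t => (h t).g := by
  have := hg.1.comp_continuous (continuous_subtype_val (p := fun t : ℝ => t ∈ Icc (0 : ℝ) 1))
    (fun t => t.2)
  refine this.congr fun t => ?_
  exact IccExtend_val _ _ t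

theorem Homotopic.mul {a a' b b' : EquivLoop IM G x} (h : Homotopic IG a a')
    (k : Homotopic IG b b') : Homotopic IG (EquivLoop.mul IG a b) (EquivLoop.mul IG a' b') := by
  have : ContinuousSMul G M := ContMDiffSMul.continuousSMul (I := IG) (I' := IM) ∞
  obtain ⟨h, hg, hc, rfl, rfl⟩ := h
  obtain ⟨k, kg, kc, rfl, rfl⟩ := k
  refine ⟨fun t => EquivLoop.mul IG (h t) (k t), ?_, ?_, rfl, rfl⟩
  · exact PiecewiseC1On.mul hg kg
  · refine Path.trans_continuous_family (fun t => (h t).path) hc (fun t => (k t).path.map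
      (contMDiff_smul_left IG (IM := IM) (h t).g).continuous) ?_
    exact ((continuous_g hg).comp continuous_fst).smul kc

theorem Homotopic.inv {a a' : EquivLoop IM G x} (h : Homotopic IG a a') :
    Homotopic IG (EquivLoop.inv IG a) (EquivLoop.inv IG a') := by
  have : ContinuousSMul G M := ContMDiffSMul.continuousSMul (I := IG) (I' := IM) ∞
  have : IsTopologicalGroup G := topologicalGroup_of_lieGroup IG ∞
  obtain ⟨h, hg, hc, rfl, rfl⟩ := h
  refine ⟨fun t => EquivLoop.inv IG (h t), ?_, ?_, rfl, rfl⟩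
  · exact PiecewiseC1On.map (f := fun y : G => y⁻¹) (contMDiff_inv IG 1) hg
  · exact ((continuous_g hg).comp continuous_fst).inv.smul
      (hc.comp (by fun_prop : Continuous fun p : unitInterval × unitInterval => (p.1, unitInterval.symm p.2)))

/-- Reparametrizing the curve does not change the class, as long as the curves of the affine
homotopy are piecewise `C¹`. -/
theorem homotopic_of_reparam (a b : EquivLoop IM G x) (hg : a.g = b.g) (f : ℝ → ℝ)
    (hf : Continuous f) (f0 : f 0 = 0) (f1 : f 1 = 1)
    (hb : ∀ s : unitInterval, b.curve s = a.path.extend (f s))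
    (hpw : ∀ t ∈ Icc (0 : ℝ) 1,
      PiecewiseC1On IM (fun s => a.path.extend ((1 - t) * s + t * f s)) 0 1) :
    Homotopic IG a b := by
  refine ⟨fun t =>
    { g := a.g
      curve := ⟨fun s => a.path.extend ((1 - (t : ℝ)) * s + t * f s), by fun_prop⟩
      source := by simp [f0]
      target := by simp [f1]
      piecewiseC1 := ?_ }, piecewiseC1On_const _, ?_, ?_, ?_⟩
  · refine PiecewiseC1On.of_affine (hpw t t.2) 1 0 (by simp) fun s hs => ?_
    rw [IccExtend_of_mem _ _ hs]
    simp
  · simp only [ContinuousMap.coe_mk]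
    fun_prop
  · ext s
    · rfl
    · simp [path_apply]
  · ext s
    · exact hg
    · simp [hb]

theorem mul_extend (a b : EquivLoop IM G x) {s : ℝ} (hs : s ∈ Icc (0 : ℝ) 1) :
    (EquivLoop.mul IG a b).path.extend s =
      if s ≤ 1 / 2 then a.path.extend (2 * s) else a.g • b.path.extend (2 * s - 1) := by
  rw [Path.extend_apply _ hs]
  rfl

theorem mul_assoc_homotopic (a b c : EquivLoop IM G x) :
    Homotopic IG (EquivLoop.mul IG a (EquivLoop.mul IG b c))
      (EquivLoop.mul IG (EquivLoop.mul IG a b) c) := by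
  have hI : ∀ s ∈ Icc (0 : ℝ) 1, (if s ≤ 1 / 4 then 2 * s else if s ≤ 1 / 2 then s + 1 / 4
      else 1 / 2 * (s + 1)) ∈ Icc (0 : ℝ) 1 := by
    rintro s ⟨h0, h1⟩
    split_ifs <;> constructor <;> linarith
  refine homotopic_of_reparam _ _ (by simp [EquivLoop.mul, mul_assoc])
    (fun s => if s ≤ 1 / 4 then 2 * s else if s ≤ 1 / 2 then s + 1 / 4 else 1 / 2 * (s + 1))
    ?_ (by norm_num) (by norm_num) ?_ ?_
  · refine Continuous.if_le (by fun_prop) (Continuous.if_le (by fun_prop) (by fun_prop)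
      (by fun_prop) (by fun_prop) ?_) (by fun_prop) (by fun_prop) ?_
    · rintro s rfl; norm_num
    · rintro s rfl; norm_num
  · rintro ⟨s, hs⟩
    have hs' := hI s hs
    obtain ⟨hs0, hs1⟩ := id hs
    rw [mul_curve, mul_extend _ _ hs']
    dsimp only at hs' ⊢
    by_cases h2 : s ≤ 1 / 2
    · rw [if_pos h2, mul_extend _ _ ⟨by linarith, by linarith⟩]
      by_cases h4 : s ≤ 1 / 4
      · simp only [if_pos h4]
        rw [if_pos (by linarith), if_pos (by linarith)]
      · simp only [if_neg h4, if_pos h2]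
        rw [if_neg (by linarith), if_neg (by linarith),
          mul_extend _ _ ⟨by linarith, by linarith⟩, if_pos (by linarith)]
        congr 2
        ring
    · have h4 : ¬ s ≤ 1 / 4 := by linarith
      simp only [if_neg h4, if_neg h2]
      rw [if_neg (by linarith), mul_extend _ _ ⟨by linarith, by linarith⟩, if_neg (by linarith)]
      change (a.g * b.g) • _ = _
      rw [mul_smul]
      congr 3
      ring
  · rintro t ⟨ht0, ht1⟩
    have hp := (EquivLoop.mul IG a (EquivLoop.mul IG b c)).pw
    refine PiecewiseC1On.glue (b := 1 / 4) ?_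
      (PiecewiseC1On.glue (b := 1 / 2) ?_ ?_ (by norm_num) (by norm_num))
      (by norm_num) (by norm_num)
    · refine hp.of_affine (1 + t) 0 (fun s hs => ⟨?_, ?_⟩) fun s hs => ?_
      · nlinarith [hs.1]
      · nlinarith [hs.1, hs.2]
      · rw [if_pos hs.2]
        congr 1
        ring
    · refine hp.of_affine 1 (t / 4) (fun s hs => ⟨?_, ?_⟩) fun s hs => ?_
      · linarith [hs.1]
      · linarith [hs.2]
      · have : (if s ≤ 1 / 4 then 2 * s else if s ≤ 1 / 2 then s + 1 / 4 else 1 / 2 * (s + 1))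
            = s + 1 / 4 := by
          rw [if_pos hs.2]
          split_ifs with h
          · linarith [hs.1]
          · rfl
        rw [this]
        congr 1
        ring
    · refine hp.of_affine (1 - t / 2) (t / 2) (fun s hs => ⟨?_, ?_⟩) fun s hs => ?_
      · nlinarith [hs.1]
      · nlinarith [hs.1, hs.2]
      · have : (if s ≤ 1 / 4 then 2 * s else if s ≤ 1 / 2 then s + 1 / 4 else 1 / 2 * (s + 1))
            = 1 / 2 * (s + 1) := by
          rw [if_neg (by linarith [hs.1])]
          split_ifs with h
          · linarith [hs.1]
          · rfl
        rw [this]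
        congr 1
        ring

theorem one_mul_homotopic (a : EquivLoop IM G x) :
    Homotopic IG a (EquivLoop.mul IG EquivLoop.one a) := by
  refine homotopic_of_reparam _ _ (by simp [EquivLoop.mul, EquivLoop.one])
    (fun s => max 0 (2 * s - 1)) (by fun_prop) (by norm_num) (by norm_num) ?_ ?_
  · rintro ⟨s, hs⟩
    rw [mul_curve]
    dsimp only
    split_ifs with h
    · rw [max_eq_left (by linarith), Path.extend_zero,
        Path.extend_apply _ ⟨by linarith [hs.1], by linarith⟩]
      rfl
    · rw [max_eq_right (by linarith)]
      exact one_smul G _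
  · rintro t ⟨ht0, ht1⟩
    refine PiecewiseC1On.glue (b := 1 / 2) ?_ ?_ (by norm_num) (by norm_num)
    · refine a.pw.of_affine (1 - t) 0 (fun s hs => ⟨?_, ?_⟩) fun s hs => ?_
      · nlinarith [hs.1]
      · nlinarith [hs.1, hs.2]
      · rw [max_eq_left (by linarith [hs.2]), mul_zero]
    · refine a.pw.of_affine (1 + t) (-t) (fun s hs => ⟨?_, ?_⟩) fun s hs => ?_
      · nlinarith [hs.1]
      · nlinarith [hs.1, hs.2]
      · rw [max_eq_right (by linarith [hs.1])]
        congr 1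
        ring

theorem inv_mul_homotopic (a : EquivLoop IM G x) :
    Homotopic IG (EquivLoop.mul IG (EquivLoop.inv IG a) a) EquivLoop.one := by
  have hsm := contMDiff_smul_left IG (IM := IM) (M := M) a.g⁻¹
  have hgx : a.g⁻¹ • a.path.extend 1 = x := by simp
  refine ⟨fun t =>
    { g := 1
      curve := ⟨fun s => a.g⁻¹ • a.path.extend ((1 - (t : ℝ)) * |2 * (s : ℝ) - 1| + t),
        hsm.continuous.comp (by fun_prop)⟩
      source := by simp
      target := by norm_num
      piecewiseC1 := ?_ }, piecewiseC1On_const _, ?_, ?_, ?_⟩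
  · obtain ⟨t, ht0, ht1⟩ := t
    refine PiecewiseC1On.glue (b := 1 / 2) ?_ ?_ (by norm_num) (by norm_num)
    · refine (a.pw.map hsm).of_affine (-2 * (1 - t)) 1 (fun s hs => ⟨?_, ?_⟩) fun s hs => ?_
      · nlinarith [hs.1, hs.2]
      · nlinarith [hs.1, hs.2]
      · rw [IccExtend_of_mem _ _ ⟨hs.1, by linarith [hs.2]⟩]
        simp only [ContinuousMap.coe_mk]
        rw [abs_of_nonpos (by linarith [hs.2])]
        congr 2
        ring
    · refine (a.pw.map hsm).of_affine (2 * (1 - t)) (2 * t - 1)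
        (fun s hs => ⟨?_, ?_⟩) fun s hs => ?_
      · nlinarith [hs.1, hs.2]
      · nlinarith [hs.1, hs.2]
      · rw [IccExtend_of_mem _ _ ⟨by linarith [hs.1], hs.2⟩]
        simp only [ContinuousMap.coe_mk]
        rw [abs_of_nonneg (by linarith [hs.1])]
        congr 2
        ring
  · exact hsm.continuous.comp (by fun_prop)
  · ext s
    · simp [EquivLoop.mul, EquivLoop.inv]
    · rw [mul_curve]
      simp only [ContinuousMap.coe_mk, Icc.coe_zero, sub_zero, one_mul, add_zero]
      obtain ⟨s, hs⟩ := s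
      dsimp only
      split_ifs with h
      · have h2 : 2 * s ∈ Icc (0 : ℝ) 1 := ⟨by linarith [hs.1], by linarith⟩
        rw [abs_of_nonpos (by linarith), Path.extend_apply _ h2, path_apply, inv_curve,
          Path.extend_apply _ ⟨by linarith, by linarith [hs.1]⟩, path_apply]
        congr 2
        apply Subtype.ext
        simp [unitInterval.symm]
      · rw [abs_of_nonneg (by linarith)]
        rfl
  · ext s
    · rfl
    · rw [one_curve]
      simp

end Group
end EquivLoop

/-- The `G`-equivariant fundamental group `π_{1,G}(M)_x = C_x^G(M) / ∼_G`. -/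
def EquivFundamentalGroup : Type _ := Quotient (EquivLoop.setoid IG IM G x)

namespace EquivFundamentalGroup

/-- The class of a pair `(φ, γ)`. -/
def mk (a : EquivLoop IM G x) : EquivFundamentalGroup IG IM G x :=
  Quotient.mk (EquivLoop.setoid IG IM G x) a

variable [LieGroup IG ∞ G] [ContMDiffSMul IG IM ∞ G M]

instance : Mul (EquivFundamentalGroup IG IM G x) :=
  ⟨Quotient.map₂ (EquivLoop.mul IG) fun _ _ h _ _ k => EquivLoop.Homotopic.mul h k⟩

instance : One (EquivFundamentalGroup IG IM G x) := ⟨mk IG IM G x EquivLoop.one⟩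

instance : Inv (EquivFundamentalGroup IG IM G x) :=
  ⟨Quotient.map (EquivLoop.inv IG) fun _ _ h => EquivLoop.Homotopic.inv h⟩

/-- `π_{1,G}(M)_x` is a group for the product `[(φ, γ)] * [(φ', γ')] = [(φ φ', γ * (φ · γ'))]`. -/
instance : Group (EquivFundamentalGroup IG IM G x) :=
  Group.ofLeftAxioms
    (by
      rintro ⟨a⟩ ⟨b⟩ ⟨c⟩
      exact Quotient.sound (EquivLoop.mul_assoc_homotopic a b c).symm)
    (by
      rintro ⟨a⟩
      exact Quotient.sound (EquivLoop.one_mul_homotopic a).symm)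
    (by
      rintro ⟨a⟩
      exact Quotient.sound (EquivLoop.inv_mul_homotopic a))

theorem mk_mul_mk (a b : EquivLoop IM G x) :
    mk IG IM G x a * mk IG IM G x b = mk IG IM G x (EquivLoop.mul IG a b) := rfl

end EquivFundamentalGroup

end FundamentalGroup

/-! ### Principal `U(1)`-bundles, connections and the equivariant curvature -/

section Bundle

variable {EG : Type*} [NormedAddCommGroup EG] [NormedSpace ℝ EG] {HG : Type*} [TopologicalSpace HG]
  {EM : Type*} [NormedAddCommGroup EM] [NormedSpace ℝ EM] {HM : Type*} [TopologicalSpace HM]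
  {EP : Type*} [NormedAddCommGroup EP] [NormedSpace ℝ EP] {HP : Type*} [TopologicalSpace HP]
  (IG : ModelWithCorners ℝ EG HG) (IM : ModelWithCorners ℝ EM HM) (IP : ModelWithCorners ℝ EP HP)
  {G : Type*} [TopologicalSpace G] [ChartedSpace HG G] [Group G]
  {M : Type*} [TopologicalSpace M] [ChartedSpace HM M]
  {P : Type*} [TopologicalSpace P] [ChartedSpace HP P]

/-- `p : P → M`, with the right action `y <• z` of `z ∈ U(1)` on `P`, is a smooth principal
`U(1)`-bundle: the projection and the action are smooth, the action preserves the fibres, and `P`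
is locally `U(1)`-equivariantly diffeomorphic to `U × U(1)` over `U ⊆ M`. -/
structure IsPrincipalCircleBundle [MulAction Circleᵐᵒᵖ P] (p : P → M) : Prop where
  contMDiff_proj : ContMDiff IP IM ∞ p
  contMDiff_action : ContMDiff (IP.prod (𝓡 1)) IP ∞ (fun q : P × Circle => q.1 <• q.2)
  proj_action : ∀ (y : P) (z : Circle), p (y <• z) = p y
  locally_trivial : ∀ x : M, ∃ e : Bundle.Trivialization Circle p, x ∈ e.baseSet ∧
    ContMDiffOn IP (IM.prod (𝓡 1)) ∞ e e.source ∧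
    ContMDiffOn (IM.prod (𝓡 1)) IP ∞ e.toOpenPartialHomeomorph.symm e.target ∧
    ∀ y ∈ e.source, ∀ z : Circle, (e (y <• z)).2 = (e y).2 * z

/-- The fundamental vector field `ξ_P` of `ξ(z) = iz` on `U(1)`: the velocity at `t = 0` of
`t ↦ y · exp(it)`. -/
def circleField [MulAction Circleᵐᵒᵖ P] (y : P) : TangentSpace IP y :=
  (mfderiv 𝓘(ℝ, ℝ) IP (fun t : ℝ => y <• Circle.exp t) 0 (1 : ℝ) :)

/-- The fundamental vector field `X_P(y) = d/dt|_{t=0} exp(-tX) • y` of `X ∈ 𝔤`, computed as the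
image of `-X ∈ T_e G` under the derivative at `e` of the orbit map `φ ↦ φ • y`. -/
def fundamentalField [MulAction G P] (X : GroupLieAlgebra IG G) (y : P) : TangentSpace IP y :=
  (mfderiv IG IP (fun φ : G => φ • y) 1 (-X) :)

/-- A connection on the principal `U(1)`-bundle `P`: a smooth `1`-form `Ξ` with values in
`iℝ = Lie(U(1))` (smooth as a function on the tangent bundle), which reproduces the generator of
the vertical fields and is `U(1)`-invariant. -/
structure IsCircleConnection [IsManifold IP ∞ P] [MulAction Circleᵐᵒᵖ P]
    (Ξ : ∀ y : P, TangentSpace IP y →L[ℝ] ℂ) : Prop where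
  contMDiff : ContMDiff IP.tangent 𝓘(ℝ, ℂ) ∞ (fun v : TangentBundle IP P => Ξ v.1 v.2)
  imaginary : ∀ (y : P) (v : TangentSpace IP y), (Ξ y v).re = 0
  vertical : ∀ y : P, Ξ y (circleField IP y) = Complex.I
  circle_invariant : ∀ (z : Circle) (y : P) (v : TangentSpace IP y),
    Ξ (y <• z) (mfderiv IP IP (fun w : P => w <• z) y v) = Ξ y v

/-- The form `Ξ` is `G`-invariant: `φ_P^* Ξ = Ξ` for all `φ ∈ G`. -/
def IsInvariantForm (G : Type*) [Group G] [MulAction G P]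
    (Ξ : ∀ y : P, TangentSpace IP y →L[ℝ] ℂ) : Prop :=
  ∀ (φ : G) (y : P) (v : TangentSpace IP y),
    Ξ (φ • y) (mfderiv IP IP (fun w : P => φ • w) y v) = Ξ y v

/-- The `1`-form `Ξ` read in the preferred chart at `c`, as a `1`-form on the model space. -/
def formInChart (Ξ : ∀ y : P, TangentSpace IP y →L[ℝ] ℂ) (c : P) (u : EP) : EP →L[ℝ] ℂ :=
  (Ξ ((extChartAt IP c).symm u)).comp (mfderiv 𝓘(ℝ, EP) IP (extChartAt IP c).symm u)

/-- The derivative at `c` of the preferred chart at `c`. -/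
def chartDeriv (c : P) : TangentSpace IP c →L[ℝ] EP :=
  (mfderiv IP 𝓘(ℝ, EP) (extChartAt IP c) c :)

/-- The exterior derivative `dΞ` of a `1`-form on the (boundaryless) manifold `P`: at `c` it is the
pullback under the chart at `c` of the exterior derivative of `Ξ` read in that chart. -/
def extDerivForm (Ξ : ∀ y : P, TangentSpace IP y →L[ℝ] ℂ) (c : P) :
    TangentSpace IP c [⋀^Fin 2]→L[ℝ] ℂ :=
  (extDeriv (fun u : EP => ContinuousAlternatingMap.ofSubsingleton ℝ EP ℂ (0 : Fin 1)
    (formInChart IP Ξ c u)) (extChartAt IP c c)).compContinuousLinearMap (chartDeriv IP c)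

theorem extDerivForm_apply (Ξ : ∀ y : P, TangentSpace IP y →L[ℝ] ℂ) (c : P)
    (h : DifferentiableAt ℝ (formInChart IP Ξ c) (extChartAt IP c c))
    (v : Fin 2 → TangentSpace IP c) :
    extDerivForm IP Ξ c v =
      fderiv ℝ (formInChart IP Ξ c) (extChartAt IP c c)
        (chartDeriv IP c (v 0)) (chartDeriv IP c (v 1)) -
      fderiv ℝ (formInChart IP Ξ c) (extChartAt IP c c)
        (chartDeriv IP c (v 1)) (chartDeriv IP c (v 0)) := by
  have hd : DifferentiableAt ℝ (fun u : EP => ContinuousAlternatingMap.ofSubsingleton ℝ EP ℂ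
      (0 : Fin 1) (formInChart IP Ξ c u)) (extChartAt IP c c) :=
    (ContinuousAlternatingMap.ofSubsingletonLIE (𝕜 := ℝ) (E := EP) (F := ℂ)
      (0 : Fin 1)).toContinuousLinearEquiv.differentiable.differentiableAt.comp _ h
  have e (w : EP) : fderiv ℝ (fun u => formInChart IP Ξ c u w) (extChartAt IP c c) =
      (fderiv ℝ (formInChart IP Ξ c) (extChartAt IP c c)).flip w := by
    ext z
    rw [fderiv_clm_apply h (by fun_prop)]
    simp
  unfold extDerivForm
  change extDeriv _ _ (fun j => chartDeriv IP c (v j)) = _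
  rw [extDeriv_apply hd, Fin.sum_univ_two]
  change (-1) ^ 0 • fderiv ℝ (fun u => formInChart IP Ξ c u (chartDeriv IP c (v 1))) _ _ +
    (-1) ^ 1 • fderiv ℝ (fun u => formInChart IP Ξ c u (chartDeriv IP c (v 0))) _ _ = _
  rw [e, e]
  simp [sub_eq_add_neg]

/-- The `2`-form `F` on `M` is the curvature `curv(Ξ)`: `p^* F = (i/2π) dΞ`. This determines `F`,
as the projection of a principal bundle is a surjective submersion. -/
def IsCurvature (p : P → M) (Ξ : ∀ y : P, TangentSpace IP y →L[ℝ] ℂ)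
    (F : ∀ x : M, TangentSpace IM x [⋀^Fin 2]→L[ℝ] ℝ) : Prop :=
  ∀ (y : P) (v : Fin 2 → TangentSpace IP y),
    ((F (p y) (fun j => mfderiv IP IM p y (v j)) : ℝ) : ℂ) =
      Complex.I / (2 * Real.pi) * extDerivForm IP Ξ y v

/-- The map `μ : 𝔤 → C^∞(M)` is the momentum of `Ξ`: `p^* μ_X = -(i/2π) Ξ(X_P)`. -/
def IsMomentum [MulAction G P] (p : P → M) (Ξ : ∀ y : P, TangentSpace IP y →L[ℝ] ℂ)
    (μ : GroupLieAlgebra IG G →ₗ[ℝ] (M → ℝ)) : Prop :=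
  ∀ (X : GroupLieAlgebra IG G) (y : P),
    ((μ X (p y) : ℝ) : ℂ) = -(Complex.I / (2 * Real.pi)) * Ξ y (fundamentalField IG IP X y)

/-- The `G`-equivariant `2`-form `F + μ` on `M` is the equivariant curvature
`curv_G(Ξ) = curv(Ξ) + μ^Ξ`. -/
def IsEquivCurvature [MulAction G P] (p : P → M) (Ξ : ∀ y : P, TangentSpace IP y →L[ℝ] ℂ)
    (F : ∀ x : M, TangentSpace IM x [⋀^Fin 2]→L[ℝ] ℝ)
    (μ : GroupLieAlgebra IG G →ₗ[ℝ] (M → ℝ)) : Prop :=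
  IsCurvature IM IP p Ξ F ∧ IsMomentum IG IP p Ξ μ

variable (G) in
/-- `Ξ` is `G`-flat: `curv_G(Ξ) = 0`, that is, `curv(Ξ) = 0` and `μ^Ξ = 0`. -/
def IsGFlat [MulAction G P] (p : P → M) (Ξ : ∀ y : P, TangentSpace IP y →L[ℝ] ℂ) : Prop :=
  IsEquivCurvature IG IM IP (G := G) p Ξ 0 0

/-! ### Horizontal lifts and equivariant holonomy -/

/-- `β : [0,1] → P` is a `Ξ`-horizontal lift of the curve `γ : [0,1] → M`: it is a piecewise `C¹`
curve over `γ` whose velocity, wherever it exists in `(0,1)`, is annihilated by `Ξ`. -/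
structure IsHorizontalLift (p : P → M) (Ξ : ∀ y : P, TangentSpace IP y →L[ℝ] ℂ)
    (γ : C(unitInterval, M)) (β : C(unitInterval, P)) : Prop where
  piecewiseC1 : PiecewiseC1 IP β
  lift : ∀ t, p (β t) = γ t
  horizontal : ∀ t ∈ Ioo (0 : ℝ) 1,
    MDifferentiableAt 𝓘(ℝ, ℝ) IP (IccExtend zero_le_one β) t →
      Ξ (IccExtend zero_le_one β t)
        (mfderiv 𝓘(ℝ, ℝ) IP (IccExtend zero_le_one β) t (1 : ℝ)) = 0

variable {IM} [MulAction G M] [MulAction G P] [MulAction Circleᵐᵒᵖ P] {x : M}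

/-- The property which characterizes the equivariant holonomy `u = Hol_φ^Ξ(γ)` of `(φ, γ)`: for
every `y` over `γ 0 = x` there is a horizontal lift of `γ` starting at `y`, and each such lift ends
at `(φ • y) · u`. -/
def IsEquivHolonomy (p : P → M) (Ξ : ∀ y : P, TangentSpace IP y →L[ℝ] ℂ)
    (a : EquivLoop IM G x) (u : Circle) : Prop :=
  ∀ y : P, p y = x →
    (∃ β : C(unitInterval, P), IsHorizontalLift IP p Ξ a.curve β ∧ β 0 = y) ∧
    ∀ β : C(unitInterval, P), IsHorizontalLift IP p Ξ a.curve β → β 0 = y →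
      β 1 = (a.g • y) <• u

/-- The equivariant holonomy `Hol_φ^Ξ(γ) ∈ U(1)`: the element of `U(1)` with the characterizing
property of `IsEquivHolonomy`. -/
def equivHolonomy (p : P → M) (Ξ : ∀ y : P, TangentSpace IP y →L[ℝ] ℂ)
    (a : EquivLoop IM G x) : Circle :=
  Classical.epsilon (IsEquivHolonomy IP p Ξ a)

end Bundle

end

/-! Vanishing curvature says that `Ξ` is closed. A closed form has local primitives
(`exists_local_primitive`), and rotating a local section of `P` by minus the imaginary part of such
a primitive makes it horizontal (`exists_flatSection`). Two flat sections through the same point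
coincide near it, since by `form_mfderiv_gauge` their difference in `U(1)` has derivative zero. The
images of flat sections therefore generate a finer topology on `P`, the leaf topology, in which `p`
is a covering with fibre the discrete circle (`LeafSpace.isCoveringMap`).

Over a piecewise `C¹` curve, being horizontal and being continuous in the leaf topology are the same
thing (`IsHorizontalLift.continuous_leaf`, `LeafSpace.isHorizontalLift`). Parallel transport thus
becomes path lifting in a covering. This matters because a homotopy `h_t(s)` is only continuous in
`t`: it can be lifted to a covering, while no differential equation along it is available.

Lift the homotopy with constant starting point `y`. The endpoints of the lifted curves form a
leaf-continuous curve over `t ↦ φ_t • x`. So do the points `(φ_t • y) · Hol(h_0)`: the momentum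
vanishes, hence orbits of `G` in `P` are horizontal (`form_orbit_eq_zero`). Both curves start at the
same point, so they end at the same point, which is the invariance of the holonomy.

Multiplicativity comes from the `G`-invariance of `Ξ`: each `φ ∈ G` is continuous for the leaf
topology, and so translates horizontal lifts to horizontal lifts. -/

noncomputable section

/-! ### Local primitives of closed one-forms -/

section LocalPrimitive

variable {EP : Type*} [NormedAddCommGroup EP] [NormedSpace ℝ EP]
  {HP : Type*} [TopologicalSpace HP] {IP : ModelWithCorners ℝ EP HP} [IP.Boundaryless]
  {P : Type*} [TopologicalSpace P] [ChartedSpace HP P] [IsManifold IP ∞ P]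
  {Ξ : ∀ y : P, TangentSpace IP y →L[ℝ] ℂ}

/-- A one-form on a vector space, as an alternating form. -/
def oneForm (A : EP → EP →L[ℝ] ℂ) (u : EP) : EP [⋀^Fin 1]→L[ℝ] ℂ :=
  ContinuousAlternatingMap.ofSubsingleton ℝ EP ℂ (0 : Fin 1) (A u)

theorem DifferentiableAt.oneForm {A : EP → EP →L[ℝ] ℂ} {u : EP} (h : DifferentiableAt ℝ A u) :
    DifferentiableAt ℝ (oneForm A) u :=
  (ContinuousAlternatingMap.ofSubsingletonLIE (𝕜 := ℝ) (E := EP) (F := ℂ)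
    (0 : Fin 1)).toContinuousLinearEquiv.differentiable.differentiableAt.comp _ h

/-- On a pair of vectors, `dA` is the antisymmetrized derivative of `A`. Symmetry is the form in
which closedness enters the Poincaré lemma on a convex set. -/
theorem fderiv_symm_of_extDeriv_eq_zero {A : EP → EP →L[ℝ] ℂ} {u : EP}
    (h : DifferentiableAt ℝ A u) (h0 : extDeriv (oneForm A) u = 0) (v w : EP) :
    fderiv ℝ A u v w = fderiv ℝ A u w v := by
  have e (w : EP) : fderiv ℝ (fun u => A u w) u = (fderiv ℝ A u).flip w := by
    ext z
    rw [fderiv_clm_apply h (by fun_prop)]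
    simp
  have : extDeriv (oneForm A) u ![v, w] = 0 := by rw [h0]; rfl
  rw [extDeriv_apply h.oneForm, Fin.sum_univ_two] at this
  change (-1) ^ 0 • fderiv ℝ (fun u => A u w) _ _ +
    (-1) ^ 1 • fderiv ℝ (fun u => A u v) _ _ = 0 at this
  rw [e, e] at this
  simpa [sub_eq_zero, ← sub_eq_add_neg] using this

-- All tangent spaces unfold to `EP`; this moves the base point of `Ξ` where rewriting would meet
-- dependent types.
omit [IsManifold IP ∞ P] [IP.Boundaryless] in
theorem form_congr (Ξ : ∀ y : P, TangentSpace IP y →L[ℝ] ℂ) {y z : P} (h : y = z) (v : EP) :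
    (Ξ y : EP →L[ℝ] ℂ) v = (Ξ z : EP →L[ℝ] ℂ) v := by
  subst h; rfl

/-- In finite dimension it is enough to evaluate on a fixed vector `w`. The result is `Ξ`, as a
function on the tangent bundle, composed with the tangent map of the inverse chart along the
constant field `w`. -/
theorem contDiffOn_formInChart [FiniteDimensional ℝ EP]
    (hΞ : ContMDiff IP.tangent 𝓘(ℝ, ℂ) ∞ (fun v : TangentBundle IP P => Ξ v.1 v.2)) (c : P) :
    ContDiffOn ℝ ∞ (formInChart IP Ξ c) (extChartAt IP c).target := by
  have ho := isOpen_extChartAt_target (I := IP) c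
  rw [contDiffOn_clm_apply]
  intro w
  have h1 : ContMDiffOn 𝓘(ℝ, EP) 𝓘(ℝ, EP).tangent ∞
      (fun u : EP => (⟨u, w⟩ : TangentBundle 𝓘(ℝ, EP) EP)) (extChartAt IP c).target :=
    contMDiffOn_vectorSpace_iff_contDiffOn.2 contDiffOn_const
  have h2 := ((contMDiffOn_extChartAt_symm (I := IP) (n := ∞) c).contMDiffOn_tangentMapWithin
    (m := ∞) le_rfl ho.uniqueMDiffOn)
  have h3 := hΞ.comp_contMDiffOn (h2.comp h1 (fun u hu => hu))
  refine (contMDiffOn_iff_contDiffOn.1 h3).congr fun u hu => ?_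
  simp only [formInChart, Function.comp, tangentMapWithin]
  rw [mfderivWithin_of_isOpen ho hu]
  rfl

/-- `extDerivForm` looks at each chart only at its centre, whereas the Poincaré lemma needs
closedness throughout one chart. The naturality of `d` under the transition map `τ` bridges the two.
-/
theorem extDeriv_formInChart [FiniteDimensional ℝ EP]
    (hΞ : ContMDiff IP.tangent 𝓘(ℝ, ℂ) ∞ (fun v : TangentBundle IP P => Ξ v.1 v.2))
    (hd : ∀ (y : P) (v : Fin 2 → TangentSpace IP y), extDerivForm IP Ξ y v = 0)
    (b : P) {u : EP} (hu : u ∈ (extChartAt IP b).target) :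
    extDeriv (oneForm (formInChart IP Ξ b)) u = 0 := by
  let c : P := (extChartAt IP b).symm u
  let τ : EP → EP := extChartAt IP c ∘ (extChartAt IP b).symm
  have hob := isOpen_extChartAt_target (I := IP) b
  have hcont := (contMDiffOn_extChartAt_symm (I := IP) (n := ∞) b)
  have hev : ∀ᶠ u' in 𝓝 u, u' ∈ (extChartAt IP b).target ∧
      (extChartAt IP b).symm u' ∈ (extChartAt IP c).source := by
    refine Filter.Eventually.and (hob.mem_nhds hu) ?_
    exact (hcont.continuousOn.continuousAt (hob.mem_nhds hu)).eventually_mem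
      (extChartAt_source_mem_nhds (I := IP) c)
  have hτs : ∀ u', u' ∈ (extChartAt IP b).target →
      (extChartAt IP b).symm u' ∈ (extChartAt IP c).source →
      ContMDiffAt 𝓘(ℝ, EP) 𝓘(ℝ, EP) ∞ τ u' := fun u' h1 h2 =>
    (contMDiffAt_extChartAt' (I := IP) (n := ∞) (by rwa [← extChartAt_source IP])).comp u' (hcont.contMDiffAt (hob.mem_nhds h1))
  have hτu : τ u = extChartAt IP c c := rfl
  -- At its centre the chart has invertible derivative, so nothing is lost in the pullback that
  -- defines `extDerivForm`.
  have hzero : extDeriv (oneForm (formInChart IP Ξ c)) (τ u) = 0 := by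
    rw [hτu]
    ext w
    obtain ⟨L, hL⟩ := isInvertible_mfderiv_extChartAt (I := IP) (mem_extChartAt_source (I := IP) c)
    have := hd c (fun i => L.symm (w i))
    unfold extDerivForm at this
    change extDeriv _ _ (fun j => chartDeriv IP c (L.symm (w j))) = 0 at this
    have hw : (fun j => chartDeriv IP c (L.symm (w j))) = w := by
      funext j
      change mfderiv IP 𝓘(ℝ, EP) (extChartAt IP c) c (L.symm (w j)) = w j
      rw [← hL]
      exact L.apply_symm_apply _
    rw [hw] at this
    exact this
  -- The form in the chart at `b` is the `τ`-pullback of the form in the chart at `c`, on a whole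
  -- neighbourhood, as needed to differentiate.
  have heq : oneForm (formInChart IP Ξ b) =ᶠ[𝓝 u] fun u' =>
      (oneForm (formInChart IP Ξ c) (τ u')).compContinuousLinearMap (fderiv ℝ τ u') := by
    filter_upwards [eventually_eventually_nhds.2 hev] with u' hu'
    obtain ⟨h1, h2⟩ := hu'.self_of_nhds
    have hA : formInChart IP Ξ b u' = (formInChart IP Ξ c (τ u')).comp (fderiv ℝ τ u') := by
      have e1 : (extChartAt IP c).symm (τ u') = (extChartAt IP b).symm u' :=
        (extChartAt IP c).left_inv h2
      have e2 : (extChartAt IP b).symm =ᶠ[𝓝 u'] (extChartAt IP c).symm ∘ τ := by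
        filter_upwards [hu'] with z hz
        exact ((extChartAt IP c).left_inv hz.2).symm
      have ht : τ u' ∈ (extChartAt IP c).target := (extChartAt IP c).map_source h2
      have hd1 : MDifferentiableAt 𝓘(ℝ, EP) IP (extChartAt IP c).symm (τ u') :=
        ((contMDiffOn_extChartAt_symm (I := IP) (n := ∞) c).contMDiffAt
          ((isOpen_extChartAt_target (I := IP) c).mem_nhds ht)).mdifferentiableAt (by simp)
      have hd2 := (hτs u' h1 h2).mdifferentiableAt (by simp)
      have e3 := e2.mfderiv_eq (I := 𝓘(ℝ, EP)) (I' := IP)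
      rw [mfderiv_comp u' hd1 hd2, mfderiv_eq_fderiv] at e3
      ext w
      have e4 : (mfderiv 𝓘(ℝ, EP) IP (extChartAt IP b).symm u' w : EP) =
          mfderiv 𝓘(ℝ, EP) IP (extChartAt IP c).symm (τ u') (fderiv ℝ τ u' w) :=
        congrArg (fun T => T w) e3
      exact (form_congr Ξ e1.symm _).trans (congrArg (Ξ ((extChartAt IP c).symm (τ u'))) e4)
    ext w
    simp only [oneForm]
    rw [hA]
    rfl
  rw [heq.extDeriv_eq, extDeriv_pullback (r := ∞), hzero]
  · ext w; simp
  · apply DifferentiableAt.oneForm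
    exact ((contDiffOn_formInChart hΞ c).contDiffAt ((isOpen_extChartAt_target c).mem_nhds
      ((extChartAt IP c).map_source hev.self_of_nhds.2))).differentiableAt (by simp)
  · exact (hτs u hu hev.self_of_nhds.2).contDiffAt
  · simpa using (ENat.LEInfty.out : (2 : ℕ∞ω) ≤ ∞)

/-- A smooth closed one-form on a manifold has a primitive near each point. -/
theorem exists_local_primitive [FiniteDimensional ℝ EP]
    (hΞ : ContMDiff IP.tangent 𝓘(ℝ, ℂ) ∞ (fun v : TangentBundle IP P => Ξ v.1 v.2))
    (hd : ∀ (y : P) (v : Fin 2 → TangentSpace IP y), extDerivForm IP Ξ y v = 0) (b : P) :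
    ∃ (W : Set P) (g : P → ℂ), IsOpen W ∧ b ∈ W ∧ ContMDiffOn IP 𝓘(ℝ, ℂ) 1 g W ∧
      ∀ y ∈ W, ∀ v : TangentSpace IP y, (mfderiv IP 𝓘(ℝ, ℂ) g y v : ℂ) = Ξ y v := by
  have ho := isOpen_extChartAt_target (I := IP) b
  obtain ⟨ε, hε, hball⟩ := Metric.isOpen_iff.1 ho _ (mem_extChartAt_target (I := IP) b)
  have hsm := contDiffOn_formInChart hΞ b
  -- The Poincaré lemma on a ball inside the chart.
  obtain ⟨f, hf⟩ := (convex_ball (extChartAt IP b b) ε).exists_forall_hasFDerivAt_of_fderiv_symmetric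
    Metric.isOpen_ball ((hsm.differentiableOn (by simp)).mono hball) (fun u hu v w =>
      fderiv_symm_of_extDeriv_eq_zero
        ((hsm.contDiffAt (ho.mem_nhds (hball hu))).differentiableAt (by simp))
        (extDeriv_formInChart hΞ hd b (hball hu)) v w)
  have hfc : ContDiffOn ℝ 1 f (Metric.ball (extChartAt IP b b) ε) := by
    rw [show (1 : ℕ∞ω) = 0 + 1 by simp, contDiffOn_succ_iff_fderiv_of_isOpen Metric.isOpen_ball]
    refine ⟨fun u hu => (hf u hu).differentiableAt.differentiableWithinAt, by simp, ?_⟩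
    refine ((hsm.mono hball).of_le (by simp)).congr fun u hu => (hf u hu).fderiv
  refine ⟨(extChartAt IP b).source ∩ extChartAt IP b ⁻¹' Metric.ball (extChartAt IP b b) ε,
    f ∘ extChartAt IP b, ?_, ?_, ?_, ?_⟩
  · exact (continuousOn_extChartAt b).isOpen_inter_preimage (isOpen_extChartAt_source b)
      Metric.isOpen_ball
  · exact ⟨mem_extChartAt_source b, Metric.mem_ball_self hε⟩
  · refine hfc.contMDiffOn.comp (((contMDiffOn_extChartAt (I := IP) (n := 1) (x := b)).mono ?_))
      (fun y hy => hy.2)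
    rw [← extChartAt_source IP]
    exact inter_subset_left
  · rintro y ⟨hy, hyb⟩ v
    have hy' : y ∈ (chartAt HP b).source := by rwa [← extChartAt_source IP]
    have d1 : MDifferentiableAt IP 𝓘(ℝ, EP) (extChartAt IP b) y :=
      (contMDiffAt_extChartAt' (n := 1) hy').mdifferentiableAt (by simp)
    have d2 := hf _ hyb
    rw [mfderiv_comp y d2.differentiableAt.mdifferentiableAt d1, mfderiv_eq_fderiv, d2.fderiv]
    have hsd := (((contMDiffOn_extChartAt_symm (I := IP) (n := 1) b).contMDiffAt
      (ho.mem_nhds (hball hyb)))).mdifferentiableAt (by simp)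
    -- Differentiating this identity turns the form read in the chart back into `Ξ`.
    have e1 : (extChartAt IP b).symm ∘ extChartAt IP b =ᶠ[𝓝 y] id := by
      filter_upwards [(isOpen_extChartAt_source (I := IP) b).mem_nhds hy] with z hz
      exact (extChartAt IP b).left_inv hz
    have e2 := e1.mfderiv_eq (I := IP) (I' := IP)
    rw [mfderiv_comp y hsd d1, mfderiv_id] at e2
    have e5 : mfderiv 𝓘(ℝ, EP) IP (extChartAt IP b).symm (extChartAt IP b y)
        (mfderiv IP 𝓘(ℝ, EP) (extChartAt IP b) y v) = v := congrArg (fun T => T v) e2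
    exact (form_congr Ξ ((extChartAt IP b).left_inv hy) _).trans (congrArg (Ξ y) e5)

end LocalPrimitive

/-! ### Change of gauge -/

section Gauge

variable {EM : Type*} [NormedAddCommGroup EM] [NormedSpace ℝ EM]
  {HM : Type*} [TopologicalSpace HM] {IM : ModelWithCorners ℝ EM HM}
  {EP : Type*} [NormedAddCommGroup EP] [NormedSpace ℝ EP]
  {HP : Type*} [TopologicalSpace HP] {IP : ModelWithCorners ℝ EP HP}
  {M : Type*} [TopologicalSpace M] [ChartedSpace HM M]
  {P : Type*} [TopologicalSpace P] [ChartedSpace HP P] [IsManifold IP ∞ P]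
  [MulAction Circleᵐᵒᵖ P] {p : P → M} {Ξ : ∀ y : P, TangentSpace IP y →L[ℝ] ℂ}
  {EN : Type*} [NormedAddCommGroup EN] [NormedSpace ℝ EN]
  {HN : Type*} [TopologicalSpace HN] {J : ModelWithCorners ℝ EN HN}
  {N : Type*} [TopologicalSpace N] [ChartedSpace HN N]

theorem circle_smul_smul (y : P) (a b : Circle) : y <• a <• b = y <• (a * b) := by
  rw [MulOpposite.op_mul, mul_smul]

namespace IsPrincipalCircleBundle

theorem contMDiff_expAction (hp : IsPrincipalCircleBundle IM IP p) :
    ContMDiff (IP.prod 𝓘(ℝ, ℝ)) IP ∞ (fun q : P × ℝ => q.1 <• Circle.exp q.2) :=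
  hp.contMDiff_action.comp (contMDiff_fst.prodMk (contMDiff_circleExp.comp contMDiff_snd))

theorem contMDiff_act (hp : IsPrincipalCircleBundle IM IP p) (z : Circle) :
    ContMDiff IP IP ∞ (fun y : P => y <• z) :=
  hp.contMDiff_action.comp (contMDiff_id.prodMk contMDiff_const)

theorem mdifferentiableAt_expAction (hp : IsPrincipalCircleBundle IM IP p) {α : N → P} {θ : N → ℝ}
    {n : N} (hα : MDifferentiableAt J IP α n) (hθ : MDifferentiableAt J 𝓘(ℝ, ℝ) θ n) :
    MDifferentiableAt J IP (fun m => α m <• Circle.exp (θ m)) n :=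
  MDifferentiableAt.comp (g := fun q : P × ℝ => q.1 <• Circle.exp q.2) (f := fun m => (α m, θ m)) n
    (hp.contMDiff_expAction.contMDiffAt.mdifferentiableAt (by simp)) (hα.prodMk hθ)

/-- `s ↦ y · exp(is)` is an orbit of a one-parameter group: shifting time by `t` amounts to
restarting at `y · exp(it)`, where the velocity is the fundamental field. -/
theorem mfderiv_exp (hp : IsPrincipalCircleBundle IM IP p) (y : P) (t τ : ℝ) :
    (mfderiv 𝓘(ℝ, ℝ) IP (fun s : ℝ => y <• Circle.exp s) t τ : EP) =
      τ • (circleField IP (y <• Circle.exp t) : EP) := by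
  have e : (fun s : ℝ => y <• Circle.exp s) =
      (fun s : ℝ => (y <• Circle.exp t) <• Circle.exp s) ∘ fun s => s - t := by
    funext s
    simp only [Function.comp, circle_smul_smul, ← Circle.exp_add]
    congr 3
    ring
  have hd : MDifferentiableAt 𝓘(ℝ, ℝ) IP
      (fun s : ℝ => (y <• Circle.exp t) <• Circle.exp s) (t - t) :=
    hp.mdifferentiableAt_expAction mdifferentiableAt_const mdifferentiableAt_id
  have hs : HasMFDerivAt 𝓘(ℝ, ℝ) 𝓘(ℝ, ℝ) (fun s : ℝ => s - t) t (ContinuousLinearMap.id ℝ ℝ) :=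
    ((hasFDerivAt_id t).sub_const t).hasMFDerivAt
  have h := (HasMFDerivAt.comp (f := fun s : ℝ => s - t) t hd.hasMFDerivAt hs).mfderiv
  rw [← e] at h
  have h1 : (mfderiv 𝓘(ℝ, ℝ) IP (fun s : ℝ => y <• Circle.exp s) t τ : EP) =
      mfderiv 𝓘(ℝ, ℝ) IP (fun s : ℝ => (y <• Circle.exp t) <• Circle.exp s) (t - t) τ :=
    congrArg (fun T => T τ) h
  rw [h1, sub_self]
  have h2 := (mfderiv 𝓘(ℝ, ℝ) IP (fun s : ℝ => (y <• Circle.exp t) <• Circle.exp s) 0).map_smul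
    τ (1 : ℝ)
  have h3 : (τ • (1 : ℝ)) = τ := mul_one τ
  exact (congrArg (mfderiv 𝓘(ℝ, ℝ) IP
    (fun s : ℝ => (y <• Circle.exp t) <• Circle.exp s) 0) h3.symm).trans h2

/-- The effect of a change of gauge on the pullback of a connection. -/
theorem form_mfderiv_gauge (hp : IsPrincipalCircleBundle IM IP p) (hΞ : IsCircleConnection IP Ξ)
    {α : N → P} {θ : N → ℝ} {n : N} (hα : MDifferentiableAt J IP α n)
    (hθ : MDifferentiableAt J 𝓘(ℝ, ℝ) θ n) (v : TangentSpace J n) :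
    Ξ (α n <• Circle.exp (θ n)) (mfderiv J IP (fun m => α m <• Circle.exp (θ m)) n v) =
      Ξ (α n) (mfderiv J IP α n v) +
        Complex.ofReal (mfderiv J 𝓘(ℝ, ℝ) θ n v) * Complex.I := by
  have hμ : MDifferentiableAt (IP.prod 𝓘(ℝ, ℝ)) IP (fun q : P × ℝ => q.1 <• Circle.exp q.2)
      (α n, θ n) := hp.contMDiff_expAction.contMDiffAt.mdifferentiableAt (by simp)
  have h := (hμ.hasMFDerivAt.comp n (hα.hasMFDerivAt.prodMk hθ.hasMFDerivAt)).mfderiv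
  have h1 : (mfderiv J IP (fun m => α m <• Circle.exp (θ m)) n v : EP) =
      mfderiv (IP.prod 𝓘(ℝ, ℝ)) IP (fun q : P × ℝ => q.1 <• Circle.exp q.2) (α n, θ n)
        (mfderiv J IP α n v, mfderiv J 𝓘(ℝ, ℝ) θ n v) :=
    congrArg (fun T => T v) h
  have h2 := mfderiv_prod_eq_add_apply (v := ((mfderiv J IP α n v, mfderiv J 𝓘(ℝ, ℝ) θ n v) :
    TangentSpace (IP.prod 𝓘(ℝ, ℝ)) (α n, θ n))) hμ
  have h3 := h1.trans h2
  refine (congrArg (Ξ (α n <• Circle.exp (θ n))) h3).trans ?_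
  refine ((Ξ (α n <• Circle.exp (θ n))).map_add _ _).trans ?_
  -- The partial derivative along `α` is handled by `U(1)`-invariance, the one along `θ` by the
  -- normalization on vertical vectors.
  congr 1
  · exact hΞ.circle_invariant _ _ _
  · refine (congrArg (Ξ (α n <• Circle.exp (θ n))) (hp.mfderiv_exp (α n) (θ n) _)).trans ?_
    refine ((Ξ (α n <• Circle.exp (θ n))).map_smul _ _).trans ?_
    rw [hΞ.vertical, Complex.real_smul]

/-- Near a pair of points of the same fibre, the difference of two points of a fibre is the
exponential of a smooth function. -/
theorem exists_difference (hp : IsPrincipalCircleBundle IM IP p) {y₀ y₁ : P} (h : p y₀ = p y₁) :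
    ∃ (W : Set (P × P)) (Θ : P × P → ℝ), IsOpen W ∧ (y₀, y₁) ∈ W ∧
      ContMDiffOn (IP.prod IP) 𝓘(ℝ, ℝ) 1 Θ W ∧
      ∀ q ∈ W, p q.1 = p q.2 → q.2 = q.1 <• Circle.exp (Θ q) := by
  obtain ⟨e, hx, hes, -, hact⟩ := hp.locally_trivial (p y₀)
  have m0 : y₀ ∈ e.source := e.mem_source.2 hx
  have m1 : y₁ ∈ e.source := e.mem_source.2 (h ▸ hx)
  have hinj : ∀ y ∈ e.source, ∀ y' ∈ e.source, p y = p y' → (e y).2 = (e y').2 → y = y' := by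
    intro y hy y' hy' h1 h2
    exact e.injOn hy hy' (Prod.ext ((e.coe_fst hy).trans (h1.trans (e.coe_fst hy').symm)) h2)
  -- Dividing by `z₀` makes `R` equal to `1` at `(y₀, y₁)`, away from the cut of the principal
  -- logarithm; adding `Complex.arg z₀` afterwards undoes the division.
  let z₀ : Circle := (e y₁).2 * ((e y₀).2)⁻¹
  let R : P × P → Circle := fun q => (e q.2).2 * ((e q.1).2)⁻¹ * z₀⁻¹
  have hfib : ContMDiffOn IP (𝓡 1) ∞ (fun y => (e y).2) e.source :=
    contMDiff_snd.comp_contMDiffOn hes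
  have hRsm : ContMDiffOn (IP.prod IP) (𝓡 1) 1 R (e.source ×ˢ e.source) := by
    refine ContMDiffOn.mul (ContMDiffOn.mul ?_ (ContMDiffOn.inv ?_)) contMDiffOn_const
    · exact (hfib.comp contMDiffOn_snd (fun q hq => hq.2)).of_le (by simp)
    · exact (hfib.comp contMDiffOn_fst (fun q hq => hq.1)).of_le (by simp)
  have hcoe : ContMDiff (𝓡 1) 𝓘(ℝ, ℂ) 1 (fun z : Circle => (z : ℂ)) := by
    have := finrank_real_complex_fact'
    exact contMDiff_coe_sphere
  have hcR := hcoe.comp_contMDiffOn hRsm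
  have hos : IsOpen (e.source ×ˢ e.source) := e.open_source.prod e.open_source
  refine ⟨e.source ×ˢ e.source ∩ (fun q => (R q : ℂ)) ⁻¹' Complex.slitPlane,
    fun q => (Complex.log (R q)).im + Complex.arg z₀, ?_, ?_, ?_, ?_⟩
  · exact hcR.continuousOn.isOpen_inter_preimage hos Complex.isOpen_slitPlane
  · refine ⟨⟨m0, m1⟩, ?_⟩
    change ((z₀ * z₀⁻¹ : Circle) : ℂ) ∈ Complex.slitPlane
    rw [mul_inv_cancel, Circle.coe_one]
    exact Complex.one_mem_slitPlane
  · have h1 : ContMDiffOn 𝓘(ℝ, ℂ) 𝓘(ℝ, ℝ) 1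
        (fun w : ℂ => (Complex.log w).im + Complex.arg z₀) Complex.slitPlane := by
      refine ContDiffOn.contMDiffOn (ContDiffOn.add ?_ contDiffOn_const)
      refine Complex.imCLM.contDiff.comp_contDiffOn (f := Complex.log) ?_
      intro w hw
      exact ((Complex.contDiffAt_log hw).restrict_scalars ℝ).contDiffWithinAt
    exact h1.comp (hcR.mono inter_subset_left) (fun q hq => hq.2)
  · rintro ⟨y, y'⟩ ⟨⟨hy, hy'⟩, -⟩ hpy
    simp only at hpy hy hy' ⊢
    refine hinj _ hy' _ ?_ ?_ ?_
    · rw [e.mem_source, hp.proj_action, ← e.mem_source]; exact hy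
    · rw [hp.proj_action]; exact hpy.symm
    · rw [hact y hy, Circle.exp_add, Complex.log_im, Circle.exp_arg, Circle.exp_arg]
      simp only [R]
      rw [inv_mul_cancel_right, mul_comm, inv_mul_cancel_right]

theorem exists_eq_act (hp : IsPrincipalCircleBundle IM IP p) {y₀ y₁ : P} (h : p y₀ = p y₁) :
    ∃ z : Circle, y₁ = y₀ <• z := by
  obtain ⟨W, Θ, -, hW, -, h'⟩ := hp.exists_difference h
  exact ⟨_, h' _ hW h⟩

theorem act_injective (hp : IsPrincipalCircleBundle IM IP p) {y : P} {z w : Circle}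
    (h : y <• z = y <• w) : z = w := by
  obtain ⟨e, hx, -, -, hact⟩ := hp.locally_trivial (p y)
  have := congrArg (fun y' => (e y').2) h
  simp only [hact y (e.mem_source.2 hx)] at this
  exact mul_left_cancel this

end IsPrincipalCircleBundle

end Gauge

/-! ### Locally constant functions -/

section LocallyConstant

/-- Without boundary, a chart target contains a ball around the image of `m₀`; a ball is convex, so
zero derivative forces constancy there. -/
theorem eventually_eq_of_mfderiv_eq_zero {EM : Type*} [NormedAddCommGroup EM] [NormedSpace ℝ EM]
    {HM : Type*} [TopologicalSpace HM] {IM : ModelWithCorners ℝ EM HM} [IM.Boundaryless]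
    {M : Type*} [TopologicalSpace M] [ChartedSpace HM M] [IsManifold IM ∞ M]
    {θ : M → ℝ} {m₀ : M} (h : ∀ᶠ m in 𝓝 m₀, MDifferentiableAt IM 𝓘(ℝ, ℝ) θ m ∧
      mfderiv IM 𝓘(ℝ, ℝ) θ m = 0) : ∀ᶠ m in 𝓝 m₀, θ m = θ m₀ := by
  have ho := isOpen_extChartAt_target (I := IM) m₀
  have hsymm := contMDiffOn_extChartAt_symm (I := IM) (n := ∞) m₀
  have hc : Filter.Tendsto (extChartAt IM m₀).symm (𝓝 (extChartAt IM m₀ m₀)) (𝓝 m₀) := by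
    have := hsymm.continuousOn.continuousAt (ho.mem_nhds (mem_extChartAt_target (I := IM) m₀))
    rwa [ContinuousAt, extChartAt_to_inv] at this
  obtain ⟨ε, hε, hball⟩ := Metric.eventually_nhds_iff_ball.1
    ((hc.eventually h).and (ho.eventually_mem (mem_extChartAt_target (I := IM) m₀)))
  have hd : ∀ u ∈ Metric.ball (extChartAt IM m₀ m₀) ε,
      HasFDerivAt (θ ∘ (extChartAt IM m₀).symm) (0 : EM →L[ℝ] ℝ) u := by
    intro u hu
    obtain ⟨⟨h1, h2⟩, h3⟩ := hball u hu
    have h4 := ((hsymm.contMDiffAt (ho.mem_nhds h3)).mdifferentiableAt (by simp)).hasMFDerivAt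
    have h5 := h1.hasMFDerivAt
    rw [h2] at h5
    have h6 := h5.comp u h4
    rw [ContinuousLinearMap.zero_comp] at h6
    exact h6.hasFDerivAt
  have hconst : ∀ u ∈ Metric.ball (extChartAt IM m₀ m₀) ε,
      θ ((extChartAt IM m₀).symm u) = θ m₀ := by
    intro u hu
    have := (convex_ball (extChartAt IM m₀ m₀) ε).is_const_of_fderivWithin_eq_zero (𝕜 := ℝ)
      (f := θ ∘ (extChartAt IM m₀).symm)
      (fun w hw => (hd w hw).differentiableAt.differentiableWithinAt)
      (fun w hw => ((hd w hw).hasFDerivWithinAt).fderivWithin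
        (Metric.isOpen_ball.uniqueDiffWithinAt hw)) hu (Metric.mem_ball_self hε)
    simpa using this
  filter_upwards [extChartAt_source_mem_nhds (I := IM) m₀,
    (continuousAt_extChartAt (I := IM) m₀).eventually_mem (Metric.ball_mem_nhds _ hε)] with m h1 h2
  rw [← hconst _ h2, (extChartAt IM m₀).left_inv h1]

theorem eventually_eq_of_deriv_eq_zero {θ : ℝ → ℝ} {a b t₀ : ℝ} {F : Finset ℝ}
    (ht₀ : t₀ ∈ Icc a b)
    (hc : ∀ᶠ t in 𝓝[Icc a b] t₀, ContinuousWithinAt θ (Icc a b) t)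
    (hd : ∀ᶠ t in 𝓝[Icc a b] t₀, t ∈ Ioo a b → t ∉ F → HasDerivAt θ 0 t) :
    ∀ᶠ t in 𝓝[Icc a b] t₀, θ t = θ t₀ := by
  obtain ⟨ε, hε, hball⟩ := Metric.eventually_nhds_iff_ball.1
    (eventually_nhdsWithin_iff.1 (hc.and hd))
  have key : ∀ t ∈ Icc a b, t ∈ Metric.ball t₀ ε → θ t = θ t₀ := by
    intro t ht htb
    have hsub : uIcc t₀ t ⊆ Icc a b ∩ Metric.ball t₀ ε :=
      (ordConnected_Icc.inter (convex_ball t₀ ε).ordConnected).uIcc_subset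
        ⟨ht₀, Metric.mem_ball_self hε⟩ ⟨ht, htb⟩
    have hsub' : uIcc t₀ t ⊆ Icc a b := hsub.trans inter_subset_left
    have hI : Ioo (min t₀ t) (max t₀ t) ⊆ Ioo a b := by
      refine Ioo_subset_Ioo (le_min ht₀.1 ht.1) (max_le ht₀.2 ht.2)
    -- This form of the fundamental theorem of calculus passes over the break points in `F`:
    -- continuity is enough there, as at the end points.
    have := MeasureTheory.integral_eq_of_hasDerivAt_off_countable θ (fun _ => 0) (a := t₀) (b := t)
      F.countable_toSet
      (fun s hs => ((hball s (hsub hs).2 (hsub hs).1).1).mono hsub')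
      (fun s hs => ((hball s (hsub (Ioo_subset_Icc_self hs.1)).2
        (hsub (Ioo_subset_Icc_self hs.1)).1).2 (hI hs.1) hs.2)) (by simp)
    simp at this
    linarith
  filter_upwards [self_mem_nhdsWithin, mem_nhdsWithin_of_mem_nhds (Metric.ball_mem_nhds t₀ hε)]
    with t h1 h2 using key t h1 h2

end LocallyConstant

/-! ### Flat sections -/

section FlatSection

variable {EM : Type*} [NormedAddCommGroup EM] [NormedSpace ℝ EM]
  {HM : Type*} [TopologicalSpace HM] (IM : ModelWithCorners ℝ EM HM)
  {EP : Type*} [NormedAddCommGroup EP] [NormedSpace ℝ EP]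
  {HP : Type*} [TopologicalSpace HP] (IP : ModelWithCorners ℝ EP HP)
  {M : Type*} [TopologicalSpace M] [ChartedSpace HM M]
  {P : Type*} [TopologicalSpace P] [ChartedSpace HP P]

/-- `σ` is a local section of `p` over the open set `V`, horizontal for `Ξ`. -/
structure IsFlatSection (p : P → M) (Ξ : ∀ y : P, TangentSpace IP y →L[ℝ] ℂ) (σ : M → P)
    (V : Set M) : Prop where
  isOpen : IsOpen V
  proj : ∀ m ∈ V, p (σ m) = m
  contMDiffOn : ContMDiffOn IM IP 1 σ V
  horizontal : ∀ m ∈ V, ∀ v : TangentSpace IM m, Ξ (σ m) (mfderiv IM IP σ m v) = 0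

variable {IM IP}
variable {p : P → M} {Ξ : ∀ y : P, TangentSpace IP y →L[ℝ] ℂ} {σ σ' : M → P} {V V' : Set M}

namespace IsFlatSection

theorem contMDiffAt (h : IsFlatSection IM IP p Ξ σ V) {m : M} (hm : m ∈ V) :
    ContMDiffAt IM IP 1 σ m :=
  h.contMDiffOn.contMDiffAt (h.isOpen.mem_nhds hm)

theorem mdifferentiableAt (h : IsFlatSection IM IP p Ξ σ V) {m : M} (hm : m ∈ V) :
    MDifferentiableAt IM IP σ m :=
  (h.contMDiffAt hm).mdifferentiableAt (by simp)

theorem form_comp_eq_zero {EN : Type*} [NormedAddCommGroup EN] [NormedSpace ℝ EN]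
    {HN : Type*} [TopologicalSpace HN] {J : ModelWithCorners ℝ EN HN}
    {N : Type*} [TopologicalSpace N] [ChartedSpace HN N]
    (h : IsFlatSection IM IP p Ξ σ V) {f : N → M} {n : N} (hn : f n ∈ V)
    (hf : MDifferentiableAt J IM f n) (v : TangentSpace J n) :
    Ξ (σ (f n)) (mfderiv J IP (fun n => σ (f n)) n v) = 0 := by
  have h1 := ((h.mdifferentiableAt hn).hasMFDerivAt.comp n hf.hasMFDerivAt).mfderiv
  have h2 : (mfderiv J IP (fun n => σ (f n)) n v : EP) =
    mfderiv IM IP σ (f n) (mfderiv J IM f n v) := congrArg (fun T => T v) h1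
  exact (congrArg (Ξ (σ (f n))) h2).trans (h.horizontal _ hn _)

variable [IsManifold IP ∞ P] [MulAction Circleᵐᵒᵖ P]

theorem act (hp : IsPrincipalCircleBundle IM IP p) (hΞ : IsCircleConnection IP Ξ)
    (h : IsFlatSection IM IP p Ξ σ V) (z : Circle) :
    IsFlatSection IM IP p Ξ (fun m => σ m <• z) V := by
  refine ⟨h.isOpen, fun m hm => by rw [hp.proj_action, h.proj m hm],
    ((hp.contMDiff_act z).of_le (by simp)).comp_contMDiffOn h.contMDiffOn, fun m hm v => ?_⟩
  -- A rotation by a fixed `z` is a change of gauge with constant `θ`, whose extra term vanishes.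
  obtain ⟨t, rfl⟩ : ∃ t, z = Circle.exp t := ⟨Complex.arg z, (Circle.exp_arg z).symm⟩
  rw [hp.form_mfderiv_gauge hΞ (α := σ) (θ := fun _ => t) (h.mdifferentiableAt hm)
    mdifferentiableAt_const, h.horizontal m hm, mfderiv_const, zero_add]
  exact mul_eq_zero_of_left Complex.ofReal_zero _

/-- As `Ξ` is invariant, `φ` preserves horizontal vectors; the inner `φ⁻¹` makes the translate a
section again. -/
theorem smul {G : Type*} [Group G] [MulAction G M] [MulAction G P]
    (hequiv : ∀ (φ : G) (y : P), p (φ • y) = φ • p y) (hinv : IsInvariantForm IP G Ξ)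
    (hM : ∀ φ : G, ContMDiff IM IM 1 (fun m : M => φ • m))
    (hP : ∀ φ : G, ContMDiff IP IP 1 (fun y : P => φ • y))
    (h : IsFlatSection IM IP p Ξ σ V) (φ : G) :
    IsFlatSection IM IP p Ξ (fun m => φ • σ (φ⁻¹ • m)) ((fun m => φ⁻¹ • m) ⁻¹' V) := by
  refine ⟨h.isOpen.preimage (hM φ⁻¹).continuous, fun m hm => ?_, ?_, fun m hm v => ?_⟩
  · rw [hequiv, h.proj _ hm, smul_inv_smul]
  · exact (hP φ).comp_contMDiffOn (h.contMDiffOn.comp (hM φ⁻¹).contMDiffOn fun m hm => hm)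
  · have hf : MDifferentiableAt IM IM (fun m : M => φ⁻¹ • m) m :=
      (hM φ⁻¹).contMDiffAt.mdifferentiableAt (by simp)
    have h0 := h.form_comp_eq_zero (f := fun m : M => φ⁻¹ • m) hm hf v
    rw [← hinv φ] at h0
    refine Eq.trans ?_ h0
    have h1 := (((hP φ).contMDiffAt.mdifferentiableAt (by simp)).hasMFDerivAt.comp m
      (MDifferentiableAt.comp m (h.mdifferentiableAt hm) hf).hasMFDerivAt).mfderiv
    exact congrArg (Ξ (φ • σ (φ⁻¹ • m))) (congrArg (fun T => T v) h1)

/-- Two flat sections which agree at a point agree near it. -/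
theorem eventually_eq [IM.Boundaryless] [IsManifold IM ∞ M]
    (hp : IsPrincipalCircleBundle IM IP p) (hΞ : IsCircleConnection IP Ξ)
    (h : IsFlatSection IM IP p Ξ σ V) (h' : IsFlatSection IM IP p Ξ σ' V') {m₀ : M}
    (hm : m₀ ∈ V) (hm' : m₀ ∈ V') (he : σ m₀ = σ' m₀) : ∀ᶠ m in 𝓝 m₀, σ m = σ' m := by
  obtain ⟨W, Θ, hWo, hW, hΘ, hdiff⟩ := hp.exists_difference (congrArg p he)
  let θ : M → ℝ := fun m => Θ (σ m, σ' m)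
  have hev : ∀ᶠ m in 𝓝 m₀, m ∈ V ∧ m ∈ V' ∧ (σ m, σ' m) ∈ W := by
    refine (h.isOpen.eventually_mem hm).and ((h'.isOpen.eventually_mem hm').and ?_)
    exact (((h.contMDiffAt hm).continuousAt).prodMk
      ((h'.contMDiffAt hm').continuousAt)).eventually_mem (hWo.mem_nhds hW)
  have hgauge : ∀ᶠ m in 𝓝 m₀, σ' m = σ m <• Circle.exp (θ m) := by
    filter_upwards [hev] with m ⟨h1, h2, h3⟩
    exact hdiff _ h3 (by rw [h.proj m h1, h'.proj m h2])
  -- Both sections being horizontal, the gauge formula leaves only `i dθ = 0`.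
  have hconst : ∀ᶠ m in 𝓝 m₀, θ m = θ m₀ := by
    refine eventually_eq_of_mfderiv_eq_zero (IM := IM) ?_
    filter_upwards [hev, hgauge.eventually_nhds] with m ⟨h1, h2, h3⟩ h4
    have hθ : MDifferentiableAt IM 𝓘(ℝ, ℝ) θ m :=
      MDifferentiableAt.comp (f := fun m => (σ m, σ' m)) (g := Θ) m
        ((hΘ.contMDiffAt (hWo.mem_nhds h3)).mdifferentiableAt (by simp))
        ((h.mdifferentiableAt h1).prodMk (h'.mdifferentiableAt h2))
    refine ⟨hθ, ContinuousLinearMap.ext fun v => ?_⟩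
    have h5 := hp.form_mfderiv_gauge hΞ (h.mdifferentiableAt h1) hθ v
    have h6 := h'.horizontal m h2 v
    have h7 : mfderiv IM IP σ' m = mfderiv IM IP (fun m => σ m <• Circle.exp (θ m)) m :=
      Filter.EventuallyEq.mfderiv_eq h4
    have h8 : Ξ (σ m <• Circle.exp (θ m))
        (mfderiv IM IP (fun m => σ m <• Circle.exp (θ m)) m v) = 0 := by
      refine (form_congr Ξ h4.self_of_nhds.symm _).trans ?_
      refine Eq.trans ?_ h6
      exact congrArg (Ξ (σ' m)) (congrArg (fun T => T v) h7.symm)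
    rw [h8, h.horizontal m h1, zero_add, eq_comm, mul_eq_zero] at h5
    exact Complex.ofReal_eq_zero.1 (h5.resolve_right Complex.I_ne_zero)
  -- `θ m₀` itself may be a nonzero multiple of `2π`; only its exponential is determined, by
  -- freeness of the action.
  have h1 : Circle.exp (θ m₀) = 1 := by
    apply hp.act_injective (y := σ m₀)
    rw [← hgauge.self_of_nhds, ← he]
    simp
  filter_upwards [hconst, hgauge] with m h2 h3
  rw [h3, h2, h1]
  simp

end IsFlatSection

/-- A horizontal curve is locally contained in the image of a flat section. -/
theorem eventually_eq_flatSection [IsManifold IP ∞ P] [MulAction Circleᵐᵒᵖ P]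
    (hp : IsPrincipalCircleBundle IM IP p) (hΞ : IsCircleConnection IP Ξ)
    (h : IsFlatSection IM IP p Ξ σ V) {β : ℝ → P} {a b t₀ : ℝ} {F : Finset ℝ}
    (hc : ContinuousOn β (Icc a b))
    (hβ : ∀ t ∈ Ioo a b, t ∉ F → MDifferentiableAt 𝓘(ℝ, ℝ) IP β t ∧
      Ξ (β t) (mfderiv 𝓘(ℝ, ℝ) IP β t (1 : ℝ)) = 0)
    (ht₀ : t₀ ∈ Icc a b) (hV : p (β t₀) ∈ V) (he : σ (p (β t₀)) = β t₀) :
    ∀ᶠ t in 𝓝[Icc a b] t₀, β t = σ (p (β t)) := by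
  obtain ⟨W, Θ, hWo, hW, hΘ, hdiff⟩ := hp.exists_difference (congrArg p he)
  let θ : ℝ → ℝ := fun t => Θ (σ (p (β t)), β t)
  have hpc : Continuous p := hp.contMDiff_proj.continuous
  have hcp : ContinuousOn (fun t => p (β t)) (Icc a b) := hpc.comp_continuousOn hc
  have hVt : ∀ᶠ t in 𝓝[Icc a b] t₀, p (β t) ∈ V :=
    (hcp t₀ ht₀).eventually_mem (h.isOpen.mem_nhds hV)
  have hcs : ∀ t ∈ Icc a b, p (β t) ∈ V →
      ContinuousWithinAt (fun t => (σ (p (β t)), β t)) (Icc a b) t := fun t ht hVt =>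
    (ContinuousAt.comp_continuousWithinAt (f := fun t => p (β t)) (g := σ)
      (h.contMDiffAt hVt).continuousAt (hcp t ht)).prodMk (hc t ht)
  have hev : ∀ᶠ t in 𝓝[Icc a b] t₀, t ∈ Icc a b ∧ p (β t) ∈ V ∧ (σ (p (β t)), β t) ∈ W := by
    refine Filter.Eventually.and self_mem_nhdsWithin (hVt.and ?_)
    exact (hcs t₀ ht₀ hV).eventually_mem (hWo.mem_nhds hW)
  have hgauge : ∀ t, p (β t) ∈ V → (σ (p (β t)), β t) ∈ W →
      β t = σ (p (β t)) <• Circle.exp (θ t) := fun t h1 h2 => hdiff _ h2 (h.proj _ h1)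
  -- The angle between `β` and the section has zero derivative off `F`, because the curve and its
  -- projection moved into the section are both horizontal.
  have hconst : ∀ᶠ t in 𝓝[Icc a b] t₀, θ t = θ t₀ := by
    refine eventually_eq_of_deriv_eq_zero (F := F) ht₀ ?_ ?_
    · filter_upwards [hev] with t ⟨h1, h2, h3⟩
      exact ContinuousAt.comp_continuousWithinAt (f := fun t => (σ (p (β t)), β t)) (g := Θ)
        (hΘ.continuousOn.continuousAt (hWo.mem_nhds h3)) (hcs t h1 h2)
    · filter_upwards [hev] with t ⟨_, h2, h3⟩ ht htF
      obtain ⟨hd, h0⟩ := hβ t ht htF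
      have hdp : MDifferentiableAt 𝓘(ℝ, ℝ) IM (fun t => p (β t)) t :=
        MDifferentiableAt.comp t (hp.contMDiff_proj.contMDiffAt.mdifferentiableAt (by simp)) hd
      have hdσ : MDifferentiableAt 𝓘(ℝ, ℝ) IP (fun t => σ (p (β t))) t :=
        MDifferentiableAt.comp (f := fun t => p (β t)) (g := σ) t (h.mdifferentiableAt h2) hdp
      have hθ : MDifferentiableAt 𝓘(ℝ, ℝ) 𝓘(ℝ, ℝ) θ t :=
        MDifferentiableAt.comp (f := fun t => (σ (p (β t)), β t)) (g := Θ) t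
          ((hΘ.contMDiffAt (hWo.mem_nhds h3)).mdifferentiableAt (by simp)) (hdσ.prodMk hd)
      have h4 : β =ᶠ[𝓝 t] fun t => σ (p (β t)) <• Circle.exp (θ t) := by
        have h5 : ∀ᶠ s in 𝓝 t, p (β s) ∈ V :=
          hdp.continuousAt.eventually_mem (h.isOpen.mem_nhds h2)
        have h6 : ∀ᶠ s in 𝓝 t, (σ (p (β s)), β s) ∈ W :=
          (hdσ.continuousAt.prodMk hd.continuousAt).eventually_mem (hWo.mem_nhds h3)
        filter_upwards [h5, h6] with s using hgauge s
      have h5 := hp.form_mfderiv_gauge hΞ hdσ hθ (1 : ℝ)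
      have h6 := h.form_comp_eq_zero (f := fun t => p (β t)) h2 hdp (1 : ℝ)
      have h7 := Filter.EventuallyEq.mfderiv_eq (I := 𝓘(ℝ, ℝ)) (I' := IP) h4
      have h8 : Ξ (σ (p (β t)) <• Circle.exp (θ t))
          (mfderiv 𝓘(ℝ, ℝ) IP (fun t => σ (p (β t)) <• Circle.exp (θ t)) t (1 : ℝ)) = 0 := by
        refine (form_congr Ξ h4.self_of_nhds.symm _).trans ?_
        refine Eq.trans ?_ h0
        exact congrArg (Ξ (β t)) (congrArg (fun T => T (1 : ℝ)) h7.symm)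
      rw [h8, h6, zero_add, eq_comm, mul_eq_zero] at h5
      have h9 := Complex.ofReal_eq_zero.1 (h5.resolve_right Complex.I_ne_zero)
      have h10 := hθ.differentiableAt.hasDerivAt
      rw [mfderiv_eq_fderiv] at h9
      have h11 : deriv θ t = 0 := h9
      rwa [h11] at h10
  have h1 : Circle.exp (θ t₀) = 1 := by
    apply hp.act_injective (y := β t₀)
    nth_rewrite 1 [← he]
    rw [← hgauge t₀ hV hW]
    simp
  filter_upwards [hconst, hev] with t h2 h3
  rw [hgauge t h3.2.1 h3.2.2, h2, h1]
  simp [h.proj _ h3.2.1]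

/-- Flat sections exist near each point, if the form is closed. -/
theorem exists_flatSection [IsManifold IP ∞ P] [IP.Boundaryless] [FiniteDimensional ℝ EP]
    [MulAction Circleᵐᵒᵖ P] (hp : IsPrincipalCircleBundle IM IP p) (hΞ : IsCircleConnection IP Ξ)
    (hd : ∀ (y : P) (v : Fin 2 → TangentSpace IP y), extDerivForm IP Ξ y v = 0) (x : M) :
    ∃ (σ : M → P) (V : Set M), x ∈ V ∧ IsFlatSection IM IP p Ξ σ V := by
  obtain ⟨e, hx, -, hes, -⟩ := hp.locally_trivial x
  let s : M → P := fun m => e.toOpenPartialHomeomorph.symm (m, 1)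
  have hs : ContMDiffOn IM IP 1 s e.baseSet := by
    refine (hes.comp (contMDiffOn_id.prodMk contMDiffOn_const) fun m hm => ?_).of_le (by simp)
    rw [mem_preimage, e.mem_target]
    exact hm
  obtain ⟨W, g, hWo, hxW, hg, hgΞ⟩ := exists_local_primitive hΞ.contMDiff hd (s x)
  have hVo : IsOpen (e.baseSet ∩ s ⁻¹' W) :=
    hs.continuousOn.isOpen_inter_preimage e.open_baseSet hWo
  have hgs : ContMDiffOn IM 𝓘(ℝ, ℂ) 1 (fun m => g (s m)) (e.baseSet ∩ s ⁻¹' W) :=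
    hg.comp (hs.mono inter_subset_left) fun m hm => hm.2
  have hθ : ContMDiffOn IM 𝓘(ℝ, ℝ) 1 (fun m => (-Complex.imCLM) (g (s m)))
      (e.baseSet ∩ s ⁻¹' W) :=
    ((-Complex.imCLM).contDiff.contMDiff).comp_contMDiffOn hgs
  -- The pullback of `Ξ` by `s` is `d(g ∘ s)` and is purely imaginary; the gauge `θ = -Im (g ∘ s)`
  -- contributes `i dθ`, which cancels it.
  refine ⟨fun m => s m <• Circle.exp ((-Complex.imCLM) (g (s m))), e.baseSet ∩ s ⁻¹' W,
    ⟨hx, hxW⟩, hVo, fun m hm => ?_, ?_, fun m hm v => ?_⟩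
  · rw [hp.proj_action]
    exact e.proj_symm_apply' hm.1
  · exact (hp.contMDiff_expAction.of_le (by simp)).comp_contMDiffOn
      ((hs.mono inter_subset_left).prodMk hθ)
  · have d1 : MDifferentiableAt IM IP s m :=
      (hs.contMDiffAt (e.open_baseSet.mem_nhds hm.1)).mdifferentiableAt (by simp)
    have d2 : MDifferentiableAt IP 𝓘(ℝ, ℂ) g (s m) :=
      (hg.contMDiffAt (hWo.mem_nhds hm.2)).mdifferentiableAt (by simp)
    have d3 : HasMFDerivAt 𝓘(ℝ, ℂ) 𝓘(ℝ, ℝ) (fun w : ℂ => (-Complex.imCLM) w) (g (s m))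
      (-Complex.imCLM) := (-Complex.imCLM).hasFDerivAt.hasMFDerivAt
    have d4 := d3.comp m (d2.hasMFDerivAt.comp m d1.hasMFDerivAt)
    refine (hp.form_mfderiv_gauge hΞ (θ := fun m => (-Complex.imCLM) (g (s m))) d1
      d4.mdifferentiableAt v).trans ?_
    have h1 : (mfderiv IM 𝓘(ℝ, ℝ) (fun m => (-Complex.imCLM) (g (s m))) m v : ℝ) =
        -(Ξ (s m) (mfderiv IM IP s m v)).im := by
      rw [← hgΞ _ hm.2]
      exact congrArg (fun T => T v) d4.mfderiv
    rw [h1]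
    apply Complex.ext
    · simp [hΞ.imaginary]
    · simp

end FlatSection

/-! ### The leaf topology of a flat bundle -/

section Leaf

variable {EM : Type*} [NormedAddCommGroup EM] [NormedSpace ℝ EM]
  {HM : Type*} [TopologicalSpace HM] (IM : ModelWithCorners ℝ EM HM)
  {EP : Type*} [NormedAddCommGroup EP] [NormedSpace ℝ EP]
  {HP : Type*} [TopologicalSpace HP] (IP : ModelWithCorners ℝ EP HP)
  {M : Type*} [TopologicalSpace M] [ChartedSpace HM M]
  {P : Type*} [TopologicalSpace P] [ChartedSpace HP P]

/-- The total space of a bundle with connection, with the topology generated by the images of the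
flat sections. -/
def LeafSpace (_ : ModelWithCorners ℝ EM HM) (IP : ModelWithCorners ℝ EP HP) (_ : P → M)
    (_ : ∀ y : P, TangentSpace IP y →L[ℝ] ℂ) : Type _ := P

variable (p : P → M) (Ξ : ∀ y : P, TangentSpace IP y →L[ℝ] ℂ)

/-- The finest topology in which all flat sections are continuous on their domains. That their
images are open is a theorem, `LeafSpace.isOpen_image`, and uses the connection. -/
instance : TopologicalSpace (LeafSpace IM IP p Ξ) where
  IsOpen U := ∀ (σ : M → P) (V : Set M), IsFlatSection IM IP p Ξ σ V → IsOpen {m ∈ V | σ m ∈ U}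
  isOpen_univ σ V h := by
    convert h.isOpen using 1
    ext m
    exact ⟨fun h1 => h1.1, fun h1 => ⟨h1, trivial⟩⟩
  isOpen_inter U U' hU hU' σ V h := by
    convert (hU σ V h).inter (hU' σ V h) using 1
    ext m
    exact ⟨fun ⟨h1, h2, h3⟩ => ⟨⟨h1, h2⟩, h1, h3⟩, fun ⟨⟨h1, h2⟩, _, h3⟩ => ⟨h1, h2, h3⟩⟩
  isOpen_sUnion S hS σ V h := by
    convert isOpen_biUnion fun U hU => hS U hU σ V h using 1
    ext m
    refine Iff.trans ?_ mem_iUnion₂.symm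
    exact ⟨fun ⟨h1, U, h2, h3⟩ => ⟨U, h2, h1, h3⟩, fun ⟨U, h2, h1, h3⟩ => ⟨h1, U, h2, h3⟩⟩

/-- The circle with the discrete topology. -/
def DiscreteCircle : Type := Circle

instance : TopologicalSpace DiscreteCircle := ⊥

instance : DiscreteTopology DiscreteCircle := ⟨rfl⟩

/-- The identity to the circle with its usual topology. -/
def DiscreteCircle.toCircle : DiscreteCircle → Circle := id

namespace LeafSpace

/-- The projection of the leaf space. -/
def proj : LeafSpace IM IP p Ξ → M := p

/-- The identity from the leaf space to the bundle. -/
def toBundle : LeafSpace IM IP p Ξ → P := id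

/-- The identity from the bundle to the leaf space. -/
def ofBundle : P → LeafSpace IM IP p Ξ := id

end LeafSpace

/-- The form `Ξ` is a connection with vanishing exterior derivative on the principal bundle `p`. -/
structure IsFlatBundle [IsManifold IP ∞ P] [MulAction Circleᵐᵒᵖ P] : Prop where
  bundle : IsPrincipalCircleBundle IM IP p
  connection : IsCircleConnection IP Ξ
  closed : ∀ (y : P) (v : Fin 2 → TangentSpace IP y), extDerivForm IP Ξ y v = 0

variable {IM IP p Ξ} [IM.Boundaryless] [IP.Boundaryless] [FiniteDimensional ℝ EP]
  [IsManifold IM ∞ M] [IsManifold IP ∞ P] [MulAction Circleᵐᵒᵖ P]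
  {σ : M → P} {V : Set M}

/-- A flat section near `p y` meets the fibre of `y`; a constant rotation keeps it flat and carries
it through `y`. -/
theorem IsFlatBundle.exists_section (H : IsFlatBundle IM IP p Ξ) (y : P) :
    ∃ (σ : M → P) (V : Set M), IsFlatSection IM IP p Ξ σ V ∧ p y ∈ V ∧ σ (p y) = y := by
  obtain ⟨σ, V, hV, h⟩ := exists_flatSection H.bundle H.connection H.closed (p y)
  obtain ⟨z, hz⟩ := H.bundle.exists_eq_act (h.proj _ hV)
  exact ⟨_, V, h.act H.bundle H.connection z, hV, hz.symm⟩

theorem IsFlatSection.continuousOn_leaf (h : IsFlatSection IM IP p Ξ σ V) :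
    ContinuousOn (fun m => LeafSpace.ofBundle IM IP p Ξ (σ m)) V :=
  (continuousOn_open_iff h.isOpen).2 fun _ hU => hU σ V h

namespace LeafSpace

/-- Another flat section that meets the image at a point stays in it near that point, by uniqueness
of flat sections. -/
theorem isOpen_image (H : IsFlatBundle IM IP p Ξ) (h : IsFlatSection IM IP p Ξ σ V) :
    IsOpen ((fun m => ofBundle IM IP p Ξ (σ m)) '' V) := by
  intro σ' V' h'
  refine isOpen_iff_mem_nhds.2 ?_
  rintro m ⟨hm', m₁, hm₁, he⟩
  have he' : σ m₁ = σ' m := he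
  obtain rfl : m₁ = m := by rw [← h.proj m₁ hm₁, he', h'.proj m hm']
  filter_upwards [h.isOpen.mem_nhds hm₁, h'.isOpen.mem_nhds hm',
    h.eventually_eq H.bundle H.connection h' hm₁ hm' he'] with a h1 h2 h3
  exact ⟨h2, a, h1, h3⟩

theorem continuous_proj : Continuous (proj IM IP p Ξ) := by
  refine ⟨fun U hU σ V h => ?_⟩
  convert h.isOpen.inter hU using 1
  ext m
  refine and_congr_right fun hm => ?_
  change p (σ m) ∈ U ↔ _
  rw [h.proj m hm]

theorem continuous_toBundle : Continuous (toBundle IM IP p Ξ) :=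
  ⟨fun _ hU _ _ h => h.contMDiffOn.continuousOn.isOpen_inter_preimage h.isOpen hU⟩

/-- The image of `σ` is a leaf neighbourhood of `f a`, so a leaf-continuous map cannot leave it at
once. -/
theorem eventually_eq {A : Type*} [TopologicalSpace A] {f : A → LeafSpace IM IP p Ξ} {a : A}
    (H : IsFlatBundle IM IP p Ξ) (h : IsFlatSection IM IP p Ξ σ V) (hf : ContinuousAt f a)
    (ha : proj IM IP p Ξ (f a) ∈ V) (he : σ (proj IM IP p Ξ (f a)) = toBundle IM IP p Ξ (f a)) :
    ∀ᶠ b in 𝓝 a, proj IM IP p Ξ (f b) ∈ V ∧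
      σ (proj IM IP p Ξ (f b)) = toBundle IM IP p Ξ (f b) := by
  filter_upwards [hf.eventually_mem ((isOpen_image H h).mem_nhds ⟨_, ha, he⟩)]
  rintro b ⟨m, hm, hb⟩
  have h1 : p (σ m) = m := h.proj m hm
  rw [← hb]
  change p (σ m) ∈ V ∧ σ (p (σ m)) = σ m
  rw [h1]
  exact ⟨hm, rfl⟩

/-- Conversely, a map that stays on one flat section inherits leaf continuity from its projection to
`M`. -/
theorem continuousWithinAt {A : Type*} [TopologicalSpace A] {f : A → P} {s : Set A} {a : A}
    (h : IsFlatSection IM IP p Ξ σ V) (hf : ContinuousWithinAt (fun b => p (f b)) s a)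
    (ha : p (f a) ∈ V) (he : σ (p (f a)) = f a) (hev : ∀ᶠ b in 𝓝[s] a, f b = σ (p (f b))) :
    ContinuousWithinAt (fun b => ofBundle IM IP p Ξ (f b)) s a := by
  have h1 : ContinuousAt (fun m => ofBundle IM IP p Ξ (σ m)) (p (f a)) :=
    h.continuousOn_leaf.continuousAt (h.isOpen.mem_nhds ha)
  refine (ContinuousAt.comp_continuousWithinAt (f := fun b => p (f b)) h1 hf).congr_of_eventuallyEq
    (hev.mono fun b hb => ?_) ?_
  · exact congrArg (ofBundle IM IP p Ξ) hb
  · exact congrArg (ofBundle IM IP p Ξ) he.symm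

theorem continuous_act (H : IsFlatBundle IM IP p Ξ) (z : Circle) :
    Continuous (fun y => ofBundle IM IP p Ξ (toBundle IM IP p Ξ y <• z)) :=
  ⟨fun _ hU _ _ h => hU _ _ (h.act H.bundle H.connection z)⟩

theorem continuous_smul {G : Type*} [Group G] [MulAction G M] [MulAction G P]
    (hequiv : ∀ (φ : G) (y : P), p (φ • y) = φ • p y) (hinv : IsInvariantForm IP G Ξ)
    (hM : ∀ φ : G, ContMDiff IM IM 1 (fun m : M => φ • m))
    (hP : ∀ φ : G, ContMDiff IP IP 1 (fun y : P => φ • y)) (φ : G) :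
    Continuous (fun y => ofBundle IM IP p Ξ (φ • toBundle IM IP p Ξ y)) := by
  refine ⟨fun U hU σ V h => ?_⟩
  -- The set to be tested for `σ` is the preimage under `φ` of the one for the translated section.
  convert (hU _ _ (h.smul hequiv hinv hM hP φ)).preimage (hM φ).continuous using 1
  ext m
  change _ ↔ φ⁻¹ • φ • m ∈ V ∧ φ • σ (φ⁻¹ • φ • m) ∈ U
  rw [inv_smul_smul]
  rfl

/-- A flat section `σ` over `V` trivializes: `(m, z) ↦ σ m · z` identifies `V` times the discrete
circle with the part over `V`, each rotate of `σ` being one sheet. -/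
theorem isCoveringMap (H : IsFlatBundle IM IP p Ξ) : IsCoveringMap (proj IM IP p Ξ) := by
  intro x
  obtain ⟨σ, V, hx, h⟩ := exists_flatSection H.bundle H.connection H.closed x
  have hc : ∀ y : P, ∃ z : Circle, p y ∈ V → y = σ (p y) <• z := by
    intro y
    by_cases hy : p y ∈ V
    · obtain ⟨z, hz⟩ := H.bundle.exists_eq_act (h.proj _ hy)
      exact ⟨z, fun _ => hz⟩
    -- An arbitrary value: outside the preimage of `V` the coordinate `c` plays no role.
    · exact ⟨1, fun h' => absurd h' hy⟩
  choose c hc using hc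
  have hcσ : ∀ m ∈ V, ∀ z : Circle, c (σ m <• z) = z := by
    intro m hm z
    have h1 : p (σ m <• z) = m := by rw [H.bundle.proj_action, h.proj m hm]
    have h2 := hc (σ m <• z) (by rwa [h1])
    rw [h1] at h2
    exact (H.bundle.act_injective h2).symm
  let C : LeafSpace IM IP p Ξ → DiscreteCircle := c
  -- The coordinate is constant on the image of each rotate of `σ`, which is open.
  have hC : ∀ y, proj IM IP p Ξ y ∈ V → ContinuousAt C y := by
    intro y hy
    have h1 := isOpen_image H (h.act H.bundle H.connection (c y))
    have h2 : y ∈ (fun m => ofBundle IM IP p Ξ (σ m <• c y)) '' V := ⟨_, hy, (hc y hy).symm⟩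
    refine (continuousAt_const (y := C y)).congr ?_
    filter_upwards [h1.mem_nhds h2]
    rintro _ ⟨m, hm, rfl⟩
    exact (hcσ m hm (c y)).symm
  refine IsEvenlyCovered.to_isEvenlyCovered_preimage (I := DiscreteCircle)
    ⟨inferInstance, V, hx, h.isOpen, h.isOpen.preimage continuous_proj, ?_⟩
  have hmem : ∀ q : V × DiscreteCircle, proj IM IP p Ξ
      (ofBundle IM IP p Ξ (σ q.1 <• q.2.toCircle)) ∈ V := by
    rintro ⟨m, z⟩
    change p (σ m <• z.toCircle) ∈ V
    rw [H.bundle.proj_action, h.proj _ m.2]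
    exact m.2
  refine ⟨{
    toFun := fun y => (⟨proj IM IP p Ξ y, y.2⟩, C y)
    invFun := fun q => ⟨ofBundle IM IP p Ξ (σ q.1 <• q.2.toCircle), hmem q⟩
    left_inv := fun y => Subtype.ext (hc y.1 y.2).symm
    right_inv := ?_
    continuous_toFun := ?_
    continuous_invFun := ?_ }, fun y => rfl⟩
  · rintro ⟨m, z⟩
    refine Prod.ext (Subtype.ext ?_) (hcσ m m.2 z)
    change p (σ m <• z.toCircle) = m
    rw [H.bundle.proj_action, h.proj _ m.2]
  · refine ((continuous_proj.comp continuous_subtype_val).subtype_mk _).prodMk ?_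
    exact continuous_iff_continuousAt.2 fun y =>
      (hC y.1 y.2).comp continuous_subtype_val.continuousAt
  · refine Continuous.subtype_mk (continuous_prod_of_discrete_right.2 fun z => ?_) _
    exact (h.act H.bundle H.connection z).continuousOn_leaf.comp_continuous
      continuous_subtype_val fun m => m.2

end LeafSpace

end Leaf

/-! ### Horizontal lifts in the leaf topology -/

theorem PiecewiseC1On.exists_mdifferentiableAt {E : Type*} [NormedAddCommGroup E] [NormedSpace ℝ E]
    {H : Type*} [TopologicalSpace H] {X : Type*} [TopologicalSpace X] [ChartedSpace H X]
    {J : ModelWithCorners ℝ E H} {γ : ℝ → X} {a b : ℝ} (h : PiecewiseC1On J γ a b) :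
    ∃ F : Finset ℝ, ∀ t ∈ Ioo a b, t ∉ F → MDifferentiableAt 𝓘(ℝ, ℝ) J γ t := by
  obtain ⟨-, F, hF⟩ := h
  refine ⟨F, fun t ht htF => ?_⟩
  obtain ⟨ε, hε, hball⟩ := Metric.isOpen_iff.1 (isOpen_Ioo.sdiff F.finite_toSet.isClosed) t
    ⟨ht, htF⟩
  rw [Real.ball_eq_Ioo] at hball
  have h1 : Icc (t - ε / 2) (t + ε / 2) ⊆ Ioo (t - ε) (t + ε) :=
    Icc_subset_Ioo (by linarith) (by linarith)
  have h2 := (hball (h1 (left_mem_Icc.2 (by linarith)))).1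
  have h3 := (hball (h1 (right_mem_Icc.2 (by linarith)))).1
  have h4 := hF (t - ε / 2) (t + ε / 2) h2.1.le (by linarith) h3.2.le
    fun r hr hr' => (hball (h1 (Ioo_subset_Icc_self hr'))).2 hr
  exact (h4.contMDiffAt (Icc_mem_nhds (by linarith) (by linarith))).mdifferentiableAt (by simp)

section Lift

variable {EM : Type*} [NormedAddCommGroup EM] [NormedSpace ℝ EM]
  {HM : Type*} [TopologicalSpace HM] {IM : ModelWithCorners ℝ EM HM}
  {EP : Type*} [NormedAddCommGroup EP] [NormedSpace ℝ EP]
  {HP : Type*} [TopologicalSpace HP] {IP : ModelWithCorners ℝ EP HP}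
  {M : Type*} [TopologicalSpace M] [ChartedSpace HM M]
  {P : Type*} [TopologicalSpace P] [ChartedSpace HP P]
  {p : P → M} {Ξ : ∀ y : P, TangentSpace IP y →L[ℝ] ℂ}
  [IM.Boundaryless] [IP.Boundaryless] [FiniteDimensional ℝ EP]
  [IsManifold IM ∞ M] [IsManifold IP ∞ P] [MulAction Circleᵐᵒᵖ P]

namespace LeafSpace

/-- Near each time the curve lies on a single flat section. Only continuity and horizontality off a
finite set are required, so that this serves both horizontal lifts and orbits of `G`. -/
theorem continuous_of_horizontal (H : IsFlatBundle IM IP p Ξ) {β : unitInterval → P}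
    (hc : Continuous β) (F : Finset ℝ)
    (hβ : ∀ t ∈ Ioo (0 : ℝ) 1, t ∉ F →
      MDifferentiableAt 𝓘(ℝ, ℝ) IP (IccExtend zero_le_one β) t ∧
      Ξ (IccExtend zero_le_one β t)
        (mfderiv 𝓘(ℝ, ℝ) IP (IccExtend zero_le_one β) t (1 : ℝ)) = 0) :
    Continuous fun t => ofBundle IM IP p Ξ (β t) := by
  have hce : Continuous (IccExtend (zero_le_one (α := ℝ)) β) := hc.Icc_extend'
  have hpc : Continuous p := H.bundle.contMDiff_proj.continuous
  have h : ContinuousOn (fun t => ofBundle IM IP p Ξ (IccExtend (zero_le_one (α := ℝ)) β t))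
      (Icc 0 1) := by
    intro t ht
    obtain ⟨σ, V, hσ, hV, he⟩ := H.exists_section (IccExtend (zero_le_one (α := ℝ)) β t)
    exact LeafSpace.continuousWithinAt hσ (hpc.comp hce).continuousWithinAt hV he
      (eventually_eq_flatSection H.bundle H.connection hσ hce.continuousOn hβ ht hV he)
  refine (h.comp_continuous continuous_subtype_val fun t => t.2).congr fun t => ?_
  exact congrArg (ofBundle IM IP p Ξ) (IccExtend_val _ _ t)

theorem eq_of_proj_eq (H : IsFlatBundle IM IP p Ξ) {f f' : unitInterval → LeafSpace IM IP p Ξ}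
    (hf : Continuous f) (hf' : Continuous f')
    (hp : ∀ t, proj IM IP p Ξ (f t) = proj IM IP p Ξ (f' t)) (h0 : f 0 = f' 0) : f = f' :=
  (isCoveringMap H).eq_of_comp_eq hf hf' (funext hp) 0 h0

/-- Curves which are continuous in the leaf topology are horizontal. -/
theorem isHorizontalLift (H : IsFlatBundle IM IP p Ξ) {γ : C(unitInterval, M)}
    (hγ : PiecewiseC1 IM γ) {f : unitInterval → LeafSpace IM IP p Ξ} (hf : Continuous f)
    (hfγ : ∀ t, proj IM IP p Ξ (f t) = γ t) :
    IsHorizontalLift IP p Ξ γ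
      ⟨fun t => toBundle IM IP p Ξ (f t), continuous_toBundle.comp hf⟩ := by
  let b : ℝ → P := IccExtend zero_le_one fun t => toBundle IM IP p Ξ (f t)
  have hbc : Continuous b := (continuous_toBundle.comp hf).Icc_extend'
  have hfc : Continuous (IccExtend (zero_le_one (α := ℝ)) f) := hf.Icc_extend'
  have hpb : ∀ s, p (b s) = IccExtend zero_le_one γ s := fun s => hfγ _
  -- Locally `b = σ ∘ γ` for a `C¹` flat section: regularity passes from `γ` to `b` with the same
  -- break points, and horizontality comes from `σ`.
  have hev : ∀ s, ∃ (σ : M → P) (V : Set M), IsFlatSection IM IP p Ξ σ V ∧ p (b s) ∈ V ∧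
      ∀ᶠ r in 𝓝 s, b r = σ (p (b r)) := by
    intro s
    obtain ⟨σ, V, hσ, hV, he⟩ := H.exists_section (b s)
    refine ⟨σ, V, hσ, hV, ?_⟩
    filter_upwards [LeafSpace.eventually_eq H hσ hfc.continuousAt hV he] with r hr
    exact hr.2.symm
  refine ⟨?_, hfγ, ?_⟩
  · obtain ⟨-, F, hF⟩ := hγ
    refine ⟨hbc.continuousOn, F, fun c d hc hcd hd hFcd t ht => ?_⟩
    obtain ⟨σ, V, hσ, hV, he⟩ := hev t
    have h1 := hF c d hc hcd hd hFcd t ht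
    have h2 : ContMDiffWithinAt 𝓘(ℝ, ℝ) IM 1 (fun r => p (b r)) (Icc c d) t :=
      h1.congr (fun r _ => hpb r) (hpb t)
    have h3 : ContMDiffWithinAt 𝓘(ℝ, ℝ) IP 1 (fun r => σ (p (b r))) (Icc c d) t :=
      ContMDiffAt.comp_contMDiffWithinAt (f := fun r => p (b r)) (g := σ) t
        (hσ.contMDiffAt hV) h2
    exact h3.congr_of_eventuallyEq (he.filter_mono nhdsWithin_le_nhds) he.self_of_nhds
  · intro t _ hd
    obtain ⟨σ, V, hσ, hV, he⟩ := hev t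
    have hd' : MDifferentiableAt 𝓘(ℝ, ℝ) IM (fun r => p (b r)) t :=
      MDifferentiableAt.comp t (H.bundle.contMDiff_proj.contMDiffAt.mdifferentiableAt (by simp)) hd
    have h1 := hσ.form_comp_eq_zero (f := fun r => p (b r)) hV hd' (1 : ℝ)
    have h2 := Filter.EventuallyEq.mfderiv_eq (I := 𝓘(ℝ, ℝ)) (I' := IP) he
    refine (form_congr Ξ he.self_of_nhds _).trans (Eq.trans ?_ h1)
    exact congrArg (Ξ (σ (p (b t)))) (congrArg (fun T => T (1 : ℝ)) h2)

end LeafSpace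

theorem IsHorizontalLift.continuous_leaf (H : IsFlatBundle IM IP p Ξ) {γ : C(unitInterval, M)}
    {β : C(unitInterval, P)} (hβ : IsHorizontalLift IP p Ξ γ β) :
    Continuous fun t => LeafSpace.ofBundle IM IP p Ξ (β t) := by
  obtain ⟨F, hF⟩ := PiecewiseC1On.exists_mdifferentiableAt hβ.piecewiseC1
  exact LeafSpace.continuous_of_horizontal H β.continuous F fun t ht htF =>
    ⟨hF t ht htF, hβ.horizontal t ht (hF t ht htF)⟩

end Lift

/-! ### Equivariant holonomy of a flat bundle -/

section Holonomy

variable {EG : Type*} [NormedAddCommGroup EG] [NormedSpace ℝ EG]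
  {HG : Type*} [TopologicalSpace HG] {IG : ModelWithCorners ℝ EG HG}
  {EM : Type*} [NormedAddCommGroup EM] [NormedSpace ℝ EM]
  {HM : Type*} [TopologicalSpace HM] {IM : ModelWithCorners ℝ EM HM} [IM.Boundaryless]
  {EP : Type*} [NormedAddCommGroup EP] [NormedSpace ℝ EP] [FiniteDimensional ℝ EP]
  {HP : Type*} [TopologicalSpace HP] {IP : ModelWithCorners ℝ EP HP} [IP.Boundaryless]
  {G : Type*} [TopologicalSpace G] [ChartedSpace HG G] [Group G] [LieGroup IG ∞ G]
  {M : Type*} [TopologicalSpace M] [ChartedSpace HM M] [IsManifold IM ∞ M]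
  [MulAction G M] [ContMDiffSMul IG IM ∞ G M]
  {P : Type*} [TopologicalSpace P] [ChartedSpace HP P] [IsManifold IP ∞ P]
  [MulAction G P] [ContMDiffSMul IG IP ∞ G P] [MulAction Circleᵐᵒᵖ P] [SMulCommClass G Circleᵐᵒᵖ P]
  {p : P → M} {Ξ : ∀ y : P, TangentSpace IP y →L[ℝ] ℂ} {x : M}

variable (IG) in
theorem contMDiff_orbit (y : P) : ContMDiff IG IP ∞ (fun φ : G => φ • y) :=
  (contMDiff_smul (I := IG) (I' := IP) (G := G) (M := P)).comp
    (contMDiff_id.prodMk contMDiff_const)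

/-- If the momentum vanishes, then velocities of orbits are horizontal. -/
theorem form_orbit_eq_zero
    (hμ : ∀ (X : GroupLieAlgebra IG G) (y : P), Ξ y (fundamentalField IG IP X y) = 0)
    {g : ℝ → G} {t : ℝ} (hg : MDifferentiableAt 𝓘(ℝ, ℝ) IG g t) (y : P) :
    Ξ (g t • y) (mfderiv 𝓘(ℝ, ℝ) IP (fun s => g s • y) t (1 : ℝ)) = 0 := by
  -- Right translation brings the curve to the identity at time `t`, so its velocity there lies in
  -- the Lie algebra and acts at the point `g t • y`.
  let k : ℝ → G := fun s => g s * (g t)⁻¹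
  have hkt : k t = 1 := mul_inv_cancel _
  have hk : MDifferentiableAt 𝓘(ℝ, ℝ) IG k t :=
    MDifferentiableAt.comp (f := g) (g := fun φ => φ * (g t)⁻¹) t
      ((contMDiff_mul_right (I := IG) (n := ∞) (a := (g t)⁻¹)).contMDiffAt.mdifferentiableAt
        (by simp)) hg
  have he : (fun s => g s • y) = (fun φ : G => φ • g t • y) ∘ k := by
    funext s
    simp [k, mul_smul]
  have ho : MDifferentiableAt IG IP (fun φ : G => φ • g t • y) (k t) :=
    (contMDiff_orbit IG (IP := IP) _).contMDiffAt.mdifferentiableAt (by simp)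
  have h1 := (HasMFDerivAt.comp (f := k) t ho.hasMFDerivAt hk.hasMFDerivAt).mfderiv
  rw [← he] at h1
  have h2 : ∀ (φ : G) (_ : φ = 1) (v : EG),
      (mfderiv IG IP (fun φ : G => φ • g t • y) φ v : EP) =
        mfderiv IG IP (fun φ : G => φ • g t • y) 1 v := by
    rintro φ rfl v
    rfl
  let X : EG := mfderiv 𝓘(ℝ, ℝ) IG k t (1 : ℝ)
  have h3 : (mfderiv 𝓘(ℝ, ℝ) IP (fun s => g s • y) t (1 : ℝ) : EP) =
      mfderiv IG IP (fun φ : G => φ • g t • y) (k t) X := congrArg (fun T => T (1 : ℝ)) h1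
  -- The sign compensates the one in the definition of `fundamentalField`.
  have h4 := hμ (-X : EG) (g t • y)
  unfold fundamentalField at h4
  have h5 : -(-X : EG) = X := neg_neg X
  refine Eq.trans ?_ h4
  refine congrArg (Ξ (g t • y)) (h3.trans ((h2 _ hkt _).trans ?_))
  exact congrArg (mfderiv IG IP (fun φ : G => φ • g t • y) 1) h5.symm

theorem LeafSpace.continuous_orbit (H : IsFlatBundle IM IP p Ξ)
    (hμ : ∀ (X : GroupLieAlgebra IG G) (y : P), Ξ y (fundamentalField IG IP X y) = 0)
    {g : unitInterval → G} (hg : PiecewiseC1 IG g) (hgc : Continuous g) (y : P) :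
    Continuous fun t => ofBundle IM IP p Ξ (g t • y) := by
  obtain ⟨F, hF⟩ := PiecewiseC1On.exists_mdifferentiableAt hg
  refine continuous_of_horizontal H ((contMDiff_orbit IG (IP := IP) y).continuous.comp hgc) F
    fun t ht htF => ⟨?_, form_orbit_eq_zero hμ (hF t ht htF) y⟩
  exact MDifferentiableAt.comp (f := IccExtend zero_le_one g) (g := fun φ : G => φ • y) t
    ((contMDiff_orbit IG (IP := IP) y).contMDiffAt.mdifferentiableAt (by simp)) (hF t ht htF)

theorem EquivLoop.exists_lift (H : IsFlatBundle IM IP p Ξ) (a : EquivLoop IM G x) {y : P}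
    (hy : p y = x) : ∃ f : C(unitInterval, LeafSpace IM IP p Ξ),
      (∀ t, LeafSpace.proj IM IP p Ξ (f t) = a.curve t) ∧
        f 0 = LeafSpace.ofBundle IM IP p Ξ y := by
  obtain ⟨f, h1, h2⟩ := (LeafSpace.isCoveringMap H).exists_path_lifts a.curve
    (LeafSpace.ofBundle IM IP p Ξ y) (a.source.trans hy.symm)
  exact ⟨f, congrFun h1, h2⟩

/-- Leaf-continuous lifts are horizontal, so holonomy can be read off from any lift to the covering.
-/
theorem IsEquivHolonomy.apply_one (H : IsFlatBundle IM IP p Ξ) {a : EquivLoop IM G x} {u : Circle}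
    (hu : IsEquivHolonomy IP p Ξ a u) {y : P} (hy : p y = x)
    {f : unitInterval → LeafSpace IM IP p Ξ} (hf : Continuous f)
    (hfa : ∀ t, LeafSpace.proj IM IP p Ξ (f t) = a.curve t)
    (h0 : f 0 = LeafSpace.ofBundle IM IP p Ξ y) :
    f 1 = LeafSpace.ofBundle IM IP p Ξ ((a.g • y) <• u) :=
  (hu y hy).2 _ (LeafSpace.isHorizontalLift H a.piecewiseC1 hf hfa) h0

/-- One lift, from `y₀`, fixes `u`. Rotating it gives the lifts from all other points of the fibre,
by uniqueness of lifts in the covering. -/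
theorem exists_isEquivHolonomy (H : IsFlatBundle IM IP p Ξ)
    (hequiv : ∀ (φ : G) (y : P), p (φ • y) = φ • p y) (a : EquivLoop IM G x) :
    ∃ u : Circle, IsEquivHolonomy IP p Ξ a u := by
  by_cases hne : ∃ y₀ : P, p y₀ = x
  swap
  · exact ⟨1, fun y hy => absurd ⟨y, hy⟩ hne⟩
  obtain ⟨y₀, hy₀⟩ := hne
  obtain ⟨f₀, hf₀, h0⟩ := a.exists_lift H hy₀
  obtain ⟨u, hu⟩ : ∃ u : Circle, LeafSpace.toBundle IM IP p Ξ (f₀ 1) = (a.g • y₀) <• u := by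
    apply H.bundle.exists_eq_act
    rw [hequiv, hy₀, ← a.target]
    exact (hf₀ 1).symm
  refine ⟨u, fun y hy => ⟨?_, fun β hβ hβ0 => ?_⟩⟩
  · obtain ⟨f, hf, hf0⟩ := a.exists_lift H hy
    exact ⟨_, LeafSpace.isHorizontalLift H a.piecewiseC1 f.continuous hf, hf0⟩
  · obtain ⟨z, rfl⟩ := H.bundle.exists_eq_act (hy₀.trans hy.symm)
    have h1 : (fun t => LeafSpace.ofBundle IM IP p Ξ (β t)) = fun t =>
        LeafSpace.ofBundle IM IP p Ξ (LeafSpace.toBundle IM IP p Ξ (f₀ t) <• z) := by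
      refine LeafSpace.eq_of_proj_eq H (hβ.continuous_leaf H)
        ((LeafSpace.continuous_act H z).comp f₀.continuous) (fun t => ?_) ?_
      · refine (hβ.lift t).trans ((hf₀ t).symm.trans ?_)
        exact (H.bundle.proj_action _ z).symm
      · change β 0 = LeafSpace.toBundle IM IP p Ξ (f₀ 0) <• z
        rw [hβ0, h0]
        rfl
    have h2 : β 1 = LeafSpace.toBundle IM IP p Ξ (f₀ 1) <• z := congrFun h1 1
    -- Independence of the starting point: `G` commutes with `U(1)`, and `U(1)` is abelian.
    rw [h2, hu, smul_comm a.g, circle_smul_smul, circle_smul_smul, mul_comm]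

theorem isEquivHolonomy_equivHolonomy (H : IsFlatBundle IM IP p Ξ)
    (hequiv : ∀ (φ : G) (y : P), p (φ • y) = φ • p y) (a : EquivLoop IM G x) :
    IsEquivHolonomy IP p Ξ a (equivHolonomy IP p Ξ a) :=
  Classical.epsilon_spec (exists_isEquivHolonomy H hequiv a)

theorem IsFlatBundle.exists_proj_eq (H : IsFlatBundle IM IP p Ξ) (x : M) : ∃ y : P, p y = x := by
  obtain ⟨σ, V, hx, h⟩ := exists_flatSection H.bundle H.connection H.closed x
  exact ⟨σ x, h.proj x hx⟩

theorem EquivLoop.Homotopic.equivHolonomy_eq (H : IsFlatBundle IM IP p Ξ)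
    (hequiv : ∀ (φ : G) (y : P), p (φ • y) = φ • p y)
    (hμ : ∀ (X : GroupLieAlgebra IG G) (y : P), Ξ y (fundamentalField IG IP X y) = 0)
    {a b : EquivLoop IM G x} (hab : EquivLoop.Homotopic IG a b) :
    equivHolonomy IP p Ξ a = equivHolonomy IP p Ξ b := by
  obtain ⟨h, hg, hc, rfl, rfl⟩ := hab
  obtain ⟨y, hy⟩ := H.exists_proj_eq x
  have cov := LeafSpace.isCoveringMap H
  -- The variables are exchanged because the homotopy is lifted along its first variable, which must
  -- be the curve parameter `s`.
  let K : C(unitInterval × unitInterval, M) :=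
    ⟨fun q => (h q.2).curve q.1, hc.comp continuous_swap⟩
  have hK : ∀ t, K (0, t) = LeafSpace.proj IM IP p Ξ
      (ContinuousMap.const unitInterval (LeafSpace.ofBundle IM IP p Ξ y) t) :=
    fun t => (h t).source.trans hy.symm
  let L := cov.liftHomotopy K (ContinuousMap.const unitInterval (LeafSpace.ofBundle IM IP p Ξ y)) hK
  have hL : ∀ t, L (1, t) = LeafSpace.ofBundle IM IP p Ξ
      (((h t).g • y) <• equivHolonomy IP p Ξ (h t)) := by
    intro t
    refine (isEquivHolonomy_equivHolonomy H hequiv (h t)).apply_one H hy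
      (f := fun s => L (s, t)) (L.continuous.comp (by fun_prop)) (fun s => ?_) ?_
    · exact congrFun (cov.liftHomotopy_lifts K _ hK) (s, t)
    · exact cov.liftHomotopy_zero K _ hK t
  -- Both sides are leaf-continuous lifts of `t ↦ φ_t • x`, the right one by vanishing momentum, and
  -- they agree at `t = 0`. At `t = 1` this compares the two holonomies.
  have h1 : (fun t => L (1, t)) = fun t => LeafSpace.ofBundle IM IP p Ξ
      (((h t).g • y) <• equivHolonomy IP p Ξ (h 0)) := by
    refine LeafSpace.eq_of_proj_eq H (L.continuous.comp (by fun_prop))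
      ((LeafSpace.continuous_act H _).comp (LeafSpace.continuous_orbit H hμ hg
        (EquivLoop.continuous_g (IG := IG) hg) y)) (fun t => ?_) (hL 0)
    refine (congrFun (cov.liftHomotopy_lifts K _ hK) (1, t)).trans ?_
    change (h t).curve 1 = p (((h t).g • y) <• equivHolonomy IP p Ξ (h 0))
    rw [H.bundle.proj_action, hequiv, hy, (h t).target]
  have h2 : ((h 1).g • y) <• equivHolonomy IP p Ξ (h 1) =
      ((h 1).g • y) <• equivHolonomy IP p Ξ (h 0) := (hL 1).symm.trans (congrFun h1 1)
  exact (H.bundle.act_injective h2).symm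

theorem equivHolonomy_mul (H : IsFlatBundle IM IP p Ξ)
    (hequiv : ∀ (φ : G) (y : P), p (φ • y) = φ • p y) (hinv : IsInvariantForm IP G Ξ)
    (a b : EquivLoop IM G x) : equivHolonomy IP p Ξ (EquivLoop.mul IG a b) =
      equivHolonomy IP p Ξ a * equivHolonomy IP p Ξ b := by
  obtain ⟨y, hy⟩ := H.exists_proj_eq x
  obtain ⟨A, hA, hA0⟩ := a.exists_lift H hy
  obtain ⟨B, hB, hB0⟩ := b.exists_lift H hy
  have ha := isEquivHolonomy_equivHolonomy H hequiv a
  have hb := isEquivHolonomy_equivHolonomy H hequiv b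
  have hab := isEquivHolonomy_equivHolonomy H hequiv (EquivLoop.mul IG a b)
  generalize equivHolonomy IP p Ξ a = u at *
  generalize equivHolonomy IP p Ξ b = v at *
  generalize equivHolonomy IP p Ξ (EquivLoop.mul IG a b) = w at *
  have hA1 := ha.apply_one H hy A.continuous hA hA0
  have hB1 := hb.apply_one H hy B.continuous hB hB0
  -- `T` covers the action of `a.g` on `M` and sends `y` to the end of the lift `A`; hence `A`
  -- followed by `T ∘ B` lifts the product curve.
  let T : LeafSpace IM IP p Ξ → LeafSpace IM IP p Ξ := fun q =>
    LeafSpace.ofBundle IM IP p Ξ ((a.g • LeafSpace.toBundle IM IP p Ξ q) <• u)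
  have hT : Continuous T := (LeafSpace.continuous_act H u).comp
    (LeafSpace.continuous_smul hequiv hinv (EquivLoop.contMDiff_smul_left IG (IM := IM))
      (EquivLoop.contMDiff_smul_left IG (IM := IP)) a.g)
  have hTp : ∀ q, LeafSpace.proj IM IP p Ξ (T q) = a.g • LeafSpace.proj IM IP p Ξ q := by
    intro q
    change p ((a.g • LeafSpace.toBundle IM IP p Ξ q) <• u) = _
    rw [H.bundle.proj_action, hequiv]
    rfl
  let γ₁ : Path (A 0) (A 1) := ⟨A, rfl, rfl⟩
  let γ₂ : Path (A 1) (T (B 1)) := ⟨⟨fun t => T (B t), hT.comp B.continuous⟩, by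
    simp only [hB0, hA1]; rfl, rfl⟩
  have h1 : (γ₁.trans γ₂) 1 = LeafSpace.ofBundle IM IP p Ξ (((a.g * b.g) • y) <• w) := by
    refine hab.apply_one H hy (γ₁.trans γ₂).continuous (fun t => ?_)
      ((γ₁.trans γ₂).source.trans hA0)
    rw [EquivLoop.mul_curve, Path.trans_apply]
    split_ifs with ht
    · rw [Path.extend_apply _ ⟨by linarith [t.2.1], by linarith⟩]
      exact hA _
    · rw [Path.extend_apply _ ⟨by linarith, by linarith [t.2.2]⟩]
      exact (hTp _).trans (congrArg (a.g • ·) (hB _))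
  rw [(γ₁.trans γ₂).target, hB1] at h1
  have h2 : (a.g • ((b.g • y) <• v)) <• u = ((a.g * b.g) • y) <• w := h1
  -- The rotations accumulate as `v * u`; commutativity of `U(1)` restores the order.
  rw [smul_comm a.g, ← mul_smul a.g, circle_smul_smul] at h2
  rw [← H.bundle.act_injective h2, mul_comm]

end Holonomy

end

/-! ### The holonomy homomorphism of a `G`-flat connection -/

theorem mainTheorem6
    {EG : Type*} [NormedAddCommGroup EG] [NormedSpace ℝ EG] [FiniteDimensional ℝ EG]
    {HG : Type*} [TopologicalSpace HG] (IG : ModelWithCorners ℝ EG HG) [IG.Boundaryless]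
    {EM : Type*} [NormedAddCommGroup EM] [NormedSpace ℝ EM] [FiniteDimensional ℝ EM]
    {HM : Type*} [TopologicalSpace HM] (IM : ModelWithCorners ℝ EM HM) [IM.Boundaryless]
    {EP : Type*} [NormedAddCommGroup EP] [NormedSpace ℝ EP] [FiniteDimensional ℝ EP]
    {HP : Type*} [TopologicalSpace HP] (IP : ModelWithCorners ℝ EP HP) [IP.Boundaryless]
    -- a Lie group `G`
    {G : Type*} [TopologicalSpace G] [ChartedSpace HG G] [Group G] [LieGroup IG ∞ G]
    -- a connected manifold `M` with a smooth action of `G`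
    {M : Type*} [TopologicalSpace M] [ChartedSpace HM M] [IsManifold IM ∞ M] [T2Space M]
    [ConnectedSpace M] [MulAction G M] [ContMDiffSMul IG IM ∞ G M]
    -- a `G`-equivariant principal `U(1)`-bundle `p : P → M`
    {P : Type*} [TopologicalSpace P] [ChartedSpace HP P] [IsManifold IP ∞ P]
    [MulAction G P] [ContMDiffSMul IG IP ∞ G P] [MulAction Circleᵐᵒᵖ P] [SMulCommClass G Circleᵐᵒᵖ P]
    (p : P → M) (hp : IsPrincipalCircleBundle IM IP p)
    (hequiv : ∀ (φ : G) (y : P), p (φ • y) = φ • p y)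
    -- a `G`-invariant connection which is `G`-flat
    (Ξ : ∀ y : P, TangentSpace IP y →L[ℝ] ℂ) (hΞ : IsCircleConnection IP Ξ)
    (hinv : IsInvariantForm IP G Ξ) (hflat : IsGFlat IG IM IP G p Ξ) (x : M) :
    -- the equivariant holonomy has its characterizing property
    (∀ a : EquivLoop IM G x, IsEquivHolonomy IP p Ξ a (equivHolonomy IP p Ξ a)) ∧
    -- it is invariant under `∼_G`
    (∀ a b : EquivLoop IM G x, EquivLoop.Homotopic IG a b →
      equivHolonomy IP p Ξ a = equivHolonomy IP p Ξ b) ∧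
    -- and it induces a group homomorphism `π_{1,G}(M)_x → U(1)`
    ∃ Hol : EquivFundamentalGroup IG IM G x →* Circle,
      ∀ a : EquivLoop IM G x,
        Hol (EquivFundamentalGroup.mk IG IM G x a) = equivHolonomy IP p Ξ a := by
  -- Both halves of `G`-flatness give the vanishing of a quantity times `± i/2π`, and this factor is
  -- nonzero.
  have H : IsFlatBundle IM IP p Ξ := by
    refine ⟨hp, hΞ, fun y v => ?_⟩
    have h := hflat.1 y v
    rw [show ((0 : ∀ x : M, TangentSpace IM x [⋀^Fin 2]→L[ℝ] ℝ) (p y)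
      (fun j => mfderiv IP IM p y (v j)) : ℝ) = 0 from rfl, Complex.ofReal_zero, eq_comm,
      mul_eq_zero] at h
    refine h.resolve_left (div_ne_zero Complex.I_ne_zero ?_)
    exact mul_ne_zero two_ne_zero (Complex.ofReal_ne_zero.2 Real.pi_ne_zero)
  have hμ : ∀ (X : GroupLieAlgebra IG G) (y : P), Ξ y (fundamentalField IG IP X y) = 0 := by
    intro X y
    have h := hflat.2 X y
    rw [show ((0 : GroupLieAlgebra IG G →ₗ[ℝ] (M → ℝ)) X (p y) : ℝ) = 0 from rfl,
      Complex.ofReal_zero, eq_comm, mul_eq_zero] at h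
    refine h.resolve_left (neg_ne_zero.2 (div_ne_zero Complex.I_ne_zero ?_))
    exact mul_ne_zero two_ne_zero (Complex.ofReal_ne_zero.2 Real.pi_ne_zero)
  have hhom : ∀ a b : EquivLoop IM G x, EquivLoop.Homotopic IG a b →
      equivHolonomy IP p Ξ a = equivHolonomy IP p Ξ b := fun a b hab =>
    hab.equivHolonomy_eq H hequiv hμ
  refine ⟨isEquivHolonomy_equivHolonomy H hequiv, hhom, MonoidHom.mk'
    (Quotient.lift (equivHolonomy IP p Ξ) hhom) ?_, fun a => rfl⟩
  rintro ⟨a⟩ ⟨b⟩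
  exact equivHolonomy_mul H hequiv hinv a b
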